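/- Let $d,r,T\ge 1$ be integers, $p\in[2,\infty]$, $\frac1p+\frac1q=1$, $D>0$ and $B>0$. *Domains.* Let $\mathbb X_p(D)$ be the collection of nonempty sets $\mathcal X\subseteq\mathbb R^d$ with $\|x-y\|_p\le D$ for all $x,y\in\mathcal X$. *Functions and oracles.* For $\mathcal X\in\mathbb X_p(D)$ let $\mathcal O_{\mathrm c,p}$ be the set of pairs $(f,O)$ where $f$ is a convex function on the (convex) domain $\mathcal X$ and $O$ is a stochastic first-order oracle: queried at $x_t\in\mathcal X$ in round $t$, it returns a random vector $\hat g_t\in\mathbb R^d$, whose law may depend on $t$, on $x_t$ and on all earlier queries and oracle answers, and which, conditionally on these, satisfies $\mathbb E[\hat g_t]\in\partial f(x_t)=\{g: f(y)\ge f(x_t)+\langle g,y-x_t\rangle\ \forall y\in\mathcal X\}$ and $\|\hat g_t\|_q\le B$ almost surely. *Algorithms and channels.* An $r$-bit channel is a Markov kernel $W$ from $\mathbb R^d$ to $\{0,1\}^r$; let $\mathcal W_{\mathrm{com},r}$ be the set of all of them. A (possibly randomized) algorithm $\pi\in\Pi_T$ interacts with the oracle for $T$ rounds: in round $t$ it chooses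 a query point $x_t\in\mathcal X$ on the basis of its earlier query points and of the messages $Y_1,\dots,Y_{t-1}$; the oracle's answer $\hat g_t$ is sent through the channel $W_t=S_t(Y_1,\dots,Y_{t-1})\in\mathcal W_{\mathrm{com},r}$ given by an adaptive channel selection strategy $S=(S_1,\dots,S_T)$, and the algorithm observes only the message $Y_t\sim W_t(\cdot\mid\hat g_t)$. After the $T$ rounds it returns a point $\hat x\in\mathcal X$ on the basis of its query points and $Y_1,\dots,Y_T$. The adaptive minmax error is $$\mathcal E^*(\mathcal X,\mathcal O_{\mathrm c,p},T,\mathcal W_{\mathrm{com},r})=\inf_{\pi\in\Pi_T}\ \inf_{S}\ \sup_{(f,O)\in\mathcal O_{\mathrm c,p}}\ \mathbb E\Big[f(\hat x)-\inf_{x\in\mathcal X}f(x)\Big].$$ *Theorem.* There is an absolute constant $c_0>0$, and one can take $c_0=\frac1{12\sqrt{58}}$, such that, whenever $T\ge\frac14\cdot\frac{d^2}{\min(2^r,d)}$, $$\sup_{\mathcal X\in\mathbb X_p(D)}\mathcal E^*(\mathcal X,\mathcal O_{\mathrm c,p},T,\mathcal W_{\mathrm{com},r})\ \ge\ \max\left\{\frac{c_0DB\,d^{1/2-1/p}}{\sqrt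 T}\sqrt{\frac{d}{\min(d,2^r)}}\,,\ \ \frac{c_0DB}{\sqrt T}\sqrt{\frac{d}{\min(d,r)}}\right\}.$$ -/

import Mathlib

open MeasureTheory ProbabilityTheory
open scoped ENNReal

noncomputable section

namespace InfoOpt

/-- Points and (sub)gradients: the space `ℝ^d`, with its Borel `σ`-algebra. -/
abbrev Pt (d : ℕ) : Type := Fin d → ℝ

/-- The `ℓ_p` norm on `ℝ^d`, `p ∈ [1, ∞]`. -/
def pNorm {d : ℕ} (p : ℝ≥0∞) (x : Pt d) : ℝ := ‖(WithLp.toLp p x : PiLp p fun _ : Fin d => ℝ)‖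

/-- The (nonempty) sets `X ⊆ ℝ^d` of `ℓ_p` diameter at most `D`. -/
def domains (d : ℕ) (p : ℝ≥0∞) (D : ℝ) : Set (Set (Pt d)) :=
  {X | X.Nonempty ∧ ∀ x ∈ X, ∀ y ∈ X, pNorm p (x - y) ≤ D}

/-- The subgradients at `x` of a function `f` on the domain `X`. -/
def subdifferential {d : ℕ} (X : Set (Pt d)) (f : Pt d → ℝ) (x : Pt d) : Set (Pt d) :=
  {g | ∀ y ∈ X, f x + g ⬝ᵥ (y - x) ≤ f y}

/-- A stochastic first-order oracle on `X`. The law of the `t`-th answer (`t = 0, 1, …`) may depend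
on the current query (the second component of the argument) and on the earlier queries and answers
(the first component); answers to different queries need not be independent, nor answers to a
repeated query identically distributed. -/
structure Oracle {d : ℕ} (X : Set (Pt d)) where
  answer : ∀ t : ℕ, Kernel ((Fin t → X × Pt d) × X) (Pt d)
  isMarkov : ∀ t, IsMarkovKernel (answer t)

/-- The pairs `(f, O)` of a convex function on `X` and an oracle with unbiased answers
(the mean of the answer to the query `x` is a subgradient of `f` at `x`) that are almost surely
bounded by `B` in the `ℓ_q` norm, `1/p + 1/q = 1`. -/
def convexClass {d : ℕ} (p : ℝ≥0∞) (B : ℝ) (X : Set (Pt d)) : Set ((Pt d → ℝ) × Oracle X) :=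
  {fO | ConvexOn ℝ X fO.1 ∧
    ∀ (t : ℕ) (h : Fin t → X × Pt d) (x : X),
      (∫ g, g ∂(fO.2.answer t (h, x))) ∈ subdifferential X fO.1 x ∧
      ∀ᵐ g ∂(fO.2.answer t (h, x)), pNorm p.conjExponent g ^ 2 ≤ B ^ 2}

/-- A channel from `ℝ^d` to the output alphabet `Y`: a Markov kernel. -/
def Channel (d : ℕ) (Y : Type) [MeasurableSpace Y] : Type :=
  {W : Kernel (Pt d) Y // IsMarkovKernel W}

/-- The `r`-bit communication-constrained channels: all channels from `ℝ^d` to `{0,1}^r`. -/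
def comChannels (d r : ℕ) : Set (Channel d (Fin r → Bool)) := Set.univ

/-- A (possibly randomized) first-order algorithm on `X` with `T` oracle queries. The `t`-th query
point (`t = 0, 1, …, T - 1`) is chosen given the earlier query points and channel outputs, and the
final point is chosen given all query points and all channel outputs. (The query rules for
`t ≥ T` are never used.) -/
structure Algorithm {d : ℕ} (X : Set (Pt d)) (Y : Type) [MeasurableSpace Y] (T : ℕ) where
  query : ∀ t : ℕ, Kernel (Fin t → X × Y) X
  output : Kernel (Fin T → X × Y) X
  isMarkov_query : ∀ t, IsMarkovKernel (query t)
  isMarkov_output : IsMarkovKernel output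

/-- An adaptive channel selection strategy: the channel used in round `t` is a function of the
earlier channel outputs. (The rules for rounds after the last one are never used.) -/
def Strategy {d : ℕ} {Y : Type} [MeasurableSpace Y] (𝒲 : Set (Channel d Y)) : Type :=
  ∀ t : ℕ, (Fin t → Y) → 𝒲

/-- What happens in one round: the query point, the oracle's answer, and the channel output. -/
abbrev Round {d : ℕ} (X : Set (Pt d)) (Y : Type) : Type := (X × Pt d) × Y

section Interaction

variable {d : ℕ} {X : Set (Pt d)} {Y : Type} [MeasurableSpace Y]
  {𝒲 : Set (Channel d Y)}

/-- The part of the history that the algorithm knows: query points and channel outputs. -/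
def seenByAlgorithm {t : ℕ} (h : Fin t → Round X Y) : Fin t → X × Y := fun i => ((h i).1.1, (h i).2)

/-- The part of the history that the oracle knows: query points and its own answers. -/
def seenByOracle {t : ℕ} (h : Fin t → Round X Y) : Fin t → X × Pt d := fun i => (h i).1

/-- The part of the history that the channel selection may use: the channel outputs. -/
def messages {t : ℕ} (h : Fin t → Round X Y) : Fin t → Y := fun i => (h i).2

theorem measurable_seenByAlgorithm {t : ℕ} :
    Measurable (seenByAlgorithm : (Fin t → Round X Y) → _) := by
  unfold seenByAlgorithm; fun_prop

theorem measurable_seenByOracle {t : ℕ} :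
    Measurable (seenByOracle : (Fin t → Round X Y) → _) := by
  unfold seenByOracle; fun_prop

theorem measurable_messages {t : ℕ} :
    Measurable (messages : (Fin t → Round X Y) → _) := by
  unfold messages; fun_prop

variable [Countable Y] [MeasurableSingletonClass Y]

/-- Round `t`, last step: given the history and the current query and answer, the answer is sent
through the channel selected on the basis of the earlier channel outputs. -/
def channelStep (S : Strategy 𝒲) (t : ℕ) :
    Kernel ((Fin t → Round X Y) × (X × Pt d)) Y where
  toFun a := (S t (messages a.1)).1.1 a.2.2
  measurable' := by
    have h : Measurable fun b : (Fin t → Y) × Pt d => (S t b.1).1.1 b.2 :=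
      measurable_from_prod_countable_right fun y => (S t y).1.1.measurable
    exact h.comp ((measurable_messages.comp measurable_fst).prodMk
      (measurable_snd.comp measurable_snd))

/-- One round given the history: query, then oracle answer, then channel output. -/
def roundKernel {T : ℕ} (O : Oracle X) (π : Algorithm X Y T) (S : Strategy 𝒲) (t : ℕ) :
    Kernel (Fin t → Round X Y) (Round X Y) :=
  ((π.query t).comap seenByAlgorithm measurable_seenByAlgorithm ⊗ₖ
    (O.answer t).comap (Prod.map seenByOracle id)
      (measurable_seenByOracle.prodMap measurable_id)) ⊗ₖ
    channelStep S t

/-- The joint law of the first `t` rounds. -/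
def law {T : ℕ} (O : Oracle X) (π : Algorithm X Y T) (S : Strategy 𝒲) :
    ∀ t : ℕ, Measure (Fin t → Round X Y)
  | 0 => Measure.dirac Fin.elim0
  | t + 1 => (law O π S t ⊗ₘ roundKernel O π S t).map
      fun p => (Fin.snoc p.1 p.2 : Fin (t + 1) → Round X Y)

/-- The law of the point that the algorithm returns after its `T` queries. -/
def outputLaw {T : ℕ} (O : Oracle X) (π : Algorithm X Y T) (S : Strategy 𝒲) : Measure X :=
  ((law O π S T).map seenByAlgorithm).bind π.output

/-- The expected optimality gap of the returned point. -/
def error {T : ℕ} (f : Pt d → ℝ) (O : Oracle X) (π : Algorithm X Y T) (S : Strategy 𝒲) : ℝ :=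
  ∫ x, (f x - ⨅ z : X, f z) ∂(outputLaw O π S)

/-- The adaptive minmax optimization error of a class `𝒪` of functions and oracles on `X`, for `T`
queries and the channel family `𝒲`. -/
def minmaxError (X : Set (Pt d)) (𝒪 : Set ((Pt d → ℝ) × Oracle X)) (T : ℕ)
    (𝒲 : Set (Channel d Y)) : EReal :=
  ⨅ (π : Algorithm X Y T) (S : Strategy 𝒲), ⨆ fO ∈ 𝒪, (error fO.1 fO.2 π S : EReal)

end Interaction

end InfoOpt

end

/-! The bound is an Assouad argument. On the cube of half side `b = D / (2 d^(1/p))`, whose ℓ_p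
diameter is at most `D`, take the linear functions with slopes `c * sgn (v i)`, one for each sign
pattern `v`, and oracles with i.i.d. answers of that mean. The minimum is `-c b d`, and coming close
to it means guessing most signs of `v`. If the transcripts under `v` and under its neighbour `flip v
i` are at total variation distance at most 1/2 on average over `v` and `i`, some `v` has error at
least `c b d / 2` (`le_minmaxError`).

The query points reveal nothing beyond the messages: relative to a measure not depending on `v`, the
transcript has the likelihood of its messages as density (`map_seenByAlgorithm_law`). Adaptivity is
absorbed by the squared Hellinger distance, which is additive over rounds once it is averaged over
the cube (`sum_sqHellinger_likelihood_le`). What remains is a bound `β`, with `T β ≤ d / 4`, on the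
sum over `i` of the squared Hellinger distances between the laws of one message under `v` and `flip
v i`, for an arbitrary channel.

Two oracles give the two terms of the maximum. A single random coordinate with a sign of bias `δ`
gives `β = 4 δ² min(2^r, d) / d`: each of the `2^r` messages contributes boundedly
(`sum_sqHellinger_sparse_le`). Independent signs of bias `δ` in all coordinates give `β = 64 δ²
min(d, r)`: the squared conditional means of the signs given a message are controlled by its
log-probability, which averages to the entropy of an `r`-bit message (`sum_sqHellinger_dense_le`).
In both cases `δ` is chosen to make `T β = d / 4`. -/

noncomputable section

namespace InfoOpt

/-! ### Likelihoods of adaptive message sequences and Hellinger distance -/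

section Likelihood

variable {Y : Type}

/-- The likelihood of a message sequence when `pr t m y` is the probability that the `t`-th message
is `y` given the earlier messages `m`. -/
def likelihood (pr : ∀ t : ℕ, (Fin t → Y) → Y → ℝ) : ∀ t : ℕ, (Fin t → Y) → ℝ
  | 0, _ => 1
  | t + 1, m => likelihood pr t (Fin.init m) * pr t (Fin.init m) (m (Fin.last t))

@[simp]
theorem likelihood_zero (pr : ∀ t : ℕ, (Fin t → Y) → Y → ℝ) (m : Fin 0 → Y) :
    likelihood pr 0 m = 1 := rfl

@[simp]
theorem likelihood_snoc (pr : ∀ t : ℕ, (Fin t → Y) → Y → ℝ) (t : ℕ) (m : Fin t → Y) (y : Y) :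
    likelihood pr (t + 1) (Fin.snoc m y : Fin (t + 1) → Y) = likelihood pr t m * pr t m y := by
  simp [likelihood]

theorem likelihood_nonneg {pr : ∀ t : ℕ, (Fin t → Y) → Y → ℝ} (h0 : ∀ t m y, 0 ≤ pr t m y)
    (t : ℕ) (m : Fin t → Y) : 0 ≤ likelihood pr t m := by
  induction t with
  | zero => simp
  | succ t ih => exact mul_nonneg (ih _) (h0 _ _ _)

variable [Fintype Y]

theorem sum_fin_succ_fun {M : Type*} [AddCommMonoid M] (t : ℕ) (F : (Fin (t + 1) → Y) → M) :
    ∑ m, F m = ∑ m : Fin t → Y, ∑ y, F (Fin.snoc m y : Fin (t + 1) → Y) := by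
  rw [← (Fin.snocEquiv fun _ : Fin (t + 1) => Y).sum_comp, Fintype.sum_prod_type,
    Finset.sum_comm]
  rfl

theorem sum_likelihood {pr : ∀ t : ℕ, (Fin t → Y) → Y → ℝ} (h1 : ∀ t m, ∑ y, pr t m y = 1)
    (t : ℕ) : ∑ m, likelihood pr t m = 1 := by
  induction t with
  | zero => simp
  | succ t ih => simp [sum_fin_succ_fun, ← Finset.mul_sum, h1, ih]

/-- The squared Hellinger distance of two nonnegative functions. -/
def sqHellinger {α : Type*} [Fintype α] (p q : α → ℝ) : ℝ := ∑ a, (√(p a) - √(q a)) ^ 2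

theorem sqHellinger_nonneg {α : Type*} [Fintype α] (p q : α → ℝ) : 0 ≤ sqHellinger p q :=
  Finset.sum_nonneg fun _ _ => sq_nonneg _

theorem sqHellinger_comm {α : Type*} [Fintype α] (p q : α → ℝ) :
    sqHellinger p q = sqHellinger q p :=
  Finset.sum_congr rfl fun _ _ => by ring

/-- The left side is exactly `(√a - √b)² + √a √b * sqHellinger p q`; then AM-GM on `√a √b`. The
symmetric form matters: each weight is the likelihood of a single vertex, hence does not depend on
the flipped coordinate. -/
theorem sum_sq_sqrt_mul_sub_le {p q : Y → ℝ} (hp : ∀ y, 0 ≤ p y) (hq : ∀ y, 0 ≤ q y)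
    (hp1 : ∑ y, p y = 1) (hq1 : ∑ y, q y = 1) {a b : ℝ} (ha : 0 ≤ a) (hb : 0 ≤ b) :
    ∑ y, (√(a * p y) - √(b * q y)) ^ 2 ≤
      (√a - √b) ^ 2 + (a * sqHellinger p q + b * sqHellinger q p) / 2 := by
  have key : ∑ y, (√(a * p y) - √(b * q y)) ^ 2 = (√a - √b) ^ 2 + √a * √b * sqHellinger p q := by
    have e : ∀ y, (√(a * p y) - √(b * q y)) ^ 2 =
        a * p y + b * q y - √a * √b * (p y + q y) + √a * √b * (√(p y) - √(q y)) ^ 2 := by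
      intro y
      rw [Real.sqrt_mul ha, Real.sqrt_mul hb]
      linear_combination (√(p y)) ^ 2 * Real.sq_sqrt ha + (a - √a * √b) * Real.sq_sqrt (hp y) +
        (√(q y)) ^ 2 * Real.sq_sqrt hb + (b - √a * √b) * Real.sq_sqrt (hq y)
    simp only [e, Finset.sum_add_distrib, Finset.sum_sub_distrib, ← Finset.mul_sum, hp1, hq1]
    rw [sqHellinger]
    linear_combination - Real.sq_sqrt ha - Real.sq_sqrt hb
  rw [key, sqHellinger_comm q p]
  have h : √a * √b ≤ (a + b) / 2 := by
    nlinarith [sq_nonneg (√a - √b), Real.sq_sqrt ha, Real.sq_sqrt hb]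
  nlinarith [mul_le_mul_of_nonneg_right h (sqHellinger_nonneg p q)]

theorem sqHellinger_likelihood_succ_le {P Q : ∀ t : ℕ, (Fin t → Y) → Y → ℝ}
    (hP : ∀ t m y, 0 ≤ P t m y) (hQ : ∀ t m y, 0 ≤ Q t m y)
    (hP1 : ∀ t m, ∑ y, P t m y = 1) (hQ1 : ∀ t m, ∑ y, Q t m y = 1) (t : ℕ) :
    sqHellinger (likelihood P (t + 1)) (likelihood Q (t + 1)) ≤
      sqHellinger (likelihood P t) (likelihood Q t) +
        ((∑ m, likelihood P t m * sqHellinger (P t m) (Q t m)) +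
          ∑ m, likelihood Q t m * sqHellinger (Q t m) (P t m)) / 2 := by
  rw [sqHellinger, sum_fin_succ_fun, ← Finset.sum_add_distrib, Finset.sum_div, sqHellinger,
    ← Finset.sum_add_distrib]
  refine Finset.sum_le_sum fun m _ => ?_
  simp only [likelihood_snoc]
  exact sum_sq_sqrt_mul_sub_le (hP t m) (hQ t m) (hP1 t m) (hQ1 t m)
    (likelihood_nonneg hP t m) (likelihood_nonneg hQ t m)

/-- Pointwise AM-GM on `|p - q| = |√p - √q| (√p + √q)`, with `(√p + √q)² ≤ 2 (p + q)`. Being linear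
in the squared distance, the bound can be summed over coordinates without a further Cauchy-Schwarz
step. -/
theorem half_sum_abs_sub_le {α : Type*} [Fintype α] {p q : α → ℝ} (hp : ∀ a, 0 ≤ p a)
    (hq : ∀ a, 0 ≤ q a) (hp1 : ∑ a, p a = 1) (hq1 : ∑ a, q a = 1) :
    (∑ a, |p a - q a|) / 2 ≤ sqHellinger p q + 1 / 4 := by
  have e : sqHellinger p q + 1 / 4 =
      ∑ a, ((√(p a) - √(q a)) ^ 2 + (p a + q a) / 8) := by
    rw [Finset.sum_add_distrib, ← Finset.sum_div, Finset.sum_add_distrib, hp1, hq1, sqHellinger]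
    norm_num
  rw [e, Finset.sum_div]
  refine Finset.sum_le_sum fun a _ => ?_
  have h1 := Real.sq_sqrt (hp a)
  have h2 := Real.sq_sqrt (hq a)
  have : |p a - q a| ≤ 2 * (√(p a) - √(q a)) ^ 2 + (p a + q a) / 4 := by
    rw [abs_le]
    constructor <;>
    nlinarith [sq_nonneg (4 * (√(p a) - √(q a)) + (√(p a) + √(q a))),
      sq_nonneg (4 * (√(p a) - √(q a)) - (√(p a) + √(q a))), sq_nonneg (√(p a) - √(q a))]
  linarith

end Likelihood

/-! ### Neighbouring vertices of the cube and tensorization over rounds -/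

section Cube

variable {d : ℕ}

/-- The neighbour of a vertex of the cube along the `i`-th coordinate. -/
def flip (v : Fin d → Bool) (i : Fin d) : Fin d → Bool := Function.update v i (!v i)

@[simp] theorem flip_same (v : Fin d → Bool) (i : Fin d) : flip v i i = !v i := by simp [flip]

theorem flip_of_ne (v : Fin d → Bool) {i j : Fin d} (h : j ≠ i) : flip v i j = v j := by
  simp [flip, h]

@[simp] theorem flip_flip (v : Fin d → Bool) (i : Fin d) : flip (flip v i) i = v := by
  simp [flip]

theorem sum_flip {M : Type*} [AddCommMonoid M] (i : Fin d) (F : (Fin d → Bool) → M) :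
    ∑ v, F (flip v i) = ∑ v, F v :=
  Equiv.sum_comp (Function.Involutive.toPerm (fun v => flip v i) fun v => flip_flip v i) F

/-- The sign `±1` encoded by a bit. -/
def sgn (b : Bool) : ℝ := if b then 1 else -1

@[simp] theorem sgn_true : sgn true = 1 := rfl
@[simp] theorem sgn_false : sgn false = -1 := rfl
@[simp] theorem sgn_not (b : Bool) : sgn (!b) = -sgn b := by cases b <;> simp
theorem sgn_mul_self (b : Bool) : sgn b * sgn b = 1 := by cases b <;> simp
theorem abs_sgn (b : Bool) : |sgn b| = 1 := by cases b <;> simp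

variable {Y : Type} [Fintype Y]

/-- Tensorization: if neighbouring vertices are hard to tell apart from one adaptively chosen
message, they are hard to tell apart from `T` messages. -/
theorem sum_sqHellinger_likelihood_le {pr : (Fin d → Bool) → ∀ t : ℕ, (Fin t → Y) → Y → ℝ}
    (h0 : ∀ v t m y, 0 ≤ pr v t m y) (h1 : ∀ v t m, ∑ y, pr v t m y = 1) {β : ℝ}
    (hβ : ∀ v t m, ∑ i, sqHellinger (pr v t m) (pr (flip v i) t m) ≤ β) (T : ℕ) :
    ∑ v, ∑ i, sqHellinger (likelihood (pr v) T) (likelihood (pr (flip v i)) T) ≤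
      2 ^ d * (T * β) := by
  induction T with
  | zero => simp [sqHellinger]
  | succ t ih =>
    have step : ∑ v, ∑ i, (∑ m, likelihood (pr v) t m *
        sqHellinger (pr v t m) (pr (flip v i) t m)) ≤ 2 ^ d * β := by
      -- For fixed `v` the weight of a message sequence is the same for all `i`, so the one-message
      -- bound applies inside the sum.
      have : ∀ v, ∑ i, (∑ m, likelihood (pr v) t m *
          sqHellinger (pr v t m) (pr (flip v i) t m)) ≤ β := by
        intro v
        rw [Finset.sum_comm]
        calc _ = ∑ m, likelihood (pr v) t m *
              ∑ i, sqHellinger (pr v t m) (pr (flip v i) t m) := by simp only [Finset.mul_sum]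
          _ ≤ ∑ m, likelihood (pr v) t m * β := Finset.sum_le_sum fun m _ =>
              mul_le_mul_of_nonneg_left (hβ v t m) (likelihood_nonneg (h0 v) t m)
          _ = β := by rw [← Finset.sum_mul, sum_likelihood (h1 v), one_mul]
      refine (Finset.sum_le_sum fun v _ => this v).trans ?_
      simp
    -- The terms weighted by the neighbour's likelihood become those weighted by the vertex's own on
    -- reindexing by the involution `v ↦ flip v i`.
    have swap : ∑ v, ∑ i, (∑ m, likelihood (pr (flip v i)) t m *
        sqHellinger (pr (flip v i) t m) (pr v t m)) =
        ∑ v, ∑ i, (∑ m, likelihood (pr v) t m *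
        sqHellinger (pr v t m) (pr (flip v i) t m)) := by
      rw [Finset.sum_comm]
      conv_rhs => rw [Finset.sum_comm]
      refine Finset.sum_congr rfl fun i _ => ?_
      rw [← sum_flip i]
      simp
    have := Finset.sum_le_sum fun (v : Fin d → Bool) (_ : v ∈ Finset.univ) =>
      Finset.sum_le_sum fun (i : Fin d) (_ : i ∈ Finset.univ) =>
        sqHellinger_likelihood_succ_le (h0 v) (h0 (flip v i)) (h1 v) (h1 (flip v i)) t
    simp only [Finset.sum_add_distrib, ← Finset.sum_div, swap] at this
    push_cast
    linarith

theorem sum_half_sum_abs_likelihood_sub_le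
    {pr : (Fin d → Bool) → ∀ t : ℕ, (Fin t → Y) → Y → ℝ}
    (h0 : ∀ v t m y, 0 ≤ pr v t m y) (h1 : ∀ v t m, ∑ y, pr v t m y = 1) {β : ℝ}
    (hβ : ∀ v t m, ∑ i, sqHellinger (pr v t m) (pr (flip v i) t m) ≤ β) (T : ℕ)
    (hT : T * β ≤ d / 4) :
    ∑ v, ∑ i, (∑ m, |likelihood (pr v) T m - likelihood (pr (flip v i)) T m|) / 2 ≤
      2 ^ d * (d / 2) := by
  have h := Finset.sum_le_sum fun (v : Fin d → Bool) (_ : v ∈ Finset.univ) =>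
      Finset.sum_le_sum fun (i : Fin d) (_ : i ∈ Finset.univ) =>
        half_sum_abs_sub_le (likelihood_nonneg (h0 v) T) (likelihood_nonneg (h0 (flip v i)) T)
          (sum_likelihood (h1 v) T) (sum_likelihood (h1 (flip v i)) T)
  have h' := sum_sqHellinger_likelihood_le h0 h1 hβ T
  simp only [Finset.sum_add_distrib] at h
  simp only [Finset.sum_const, Finset.card_univ, Fintype.card_pi, Fintype.card_bool,
    Finset.prod_const, Fintype.card_fin, nsmul_eq_mul] at h
  push_cast at h
  have : (2 : ℝ) ^ d * (T * β) ≤ 2 ^ d * (d / 4) := by gcongr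
  linarith

end Cube

theorem measurable_snoc {α : Type*} [MeasurableSpace α] (t : ℕ) :
    Measurable fun a : (Fin t → α) × α => (Fin.snoc a.1 a.2 : Fin (t + 1) → α) := by
  refine measurable_pi_iff.2 fun i => ?_
  induction i using Fin.lastCases with
  | last => simpa using measurable_snd
  | cast i =>
    simp only [Fin.snoc_castSucc]
    fun_prop

/-! ### Oracle laws of finite support -/

section Mixture

variable {d : ℕ} {Ω : Type} [Fintype Ω]

/-- The law of `G ω` where `ω` has the probability mass function `μ`. -/
def discreteLaw (μ : Ω → ℝ) (G : Ω → Pt d) : Measure (Pt d) :=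
  ∑ ω, ENNReal.ofReal (μ ω) • Measure.dirac (G ω)

theorem isProbabilityMeasure_discreteLaw {μ : Ω → ℝ} (G : Ω → Pt d) (h0 : ∀ ω, 0 ≤ μ ω)
    (h1 : ∑ ω, μ ω = 1) : IsProbabilityMeasure (discreteLaw μ G) := by
  constructor
  simp [discreteLaw, ← ENNReal.ofReal_sum_of_nonneg fun ω _ => h0 ω, h1]

theorem integral_discreteLaw {E : Type*} [NormedAddCommGroup E] [NormedSpace ℝ E]
    [CompleteSpace E] {μ : Ω → ℝ} (G : Ω → Pt d) (h0 : ∀ ω, 0 ≤ μ ω) (f : Pt d → E) :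
    ∫ g, f g ∂discreteLaw μ G = ∑ ω, μ ω • f (G ω) := by
  rw [discreteLaw, integral_finsetSum_measure]
  · refine Finset.sum_congr rfl fun ω _ => ?_
    rw [integral_smul_measure, integral_dirac, ENNReal.toReal_ofReal (h0 ω)]
  · intro ω _
    exact (integrable_dirac (by simp)).smul_measure ENNReal.ofReal_ne_top

theorem ae_discreteLaw {μ : Ω → ℝ} {G : Ω → Pt d} {p : Pt d → Prop} (h : ∀ ω, p (G ω)) :
    ∀ᵐ g ∂discreteLaw μ G, p g := by
  rw [discreteLaw, ae_iff, Measure.finsetSum_apply]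
  refine Finset.sum_eq_zero fun ω _ => ?_
  simp [h ω]

end Mixture

/-! ### Density of the transcript with respect to a reference measure -/

section Transcript

variable {d : ℕ} {X : Set (Pt d)} {Y : Type}

/-- The messages in what the algorithm has seen. -/
def seenMessages {t : ℕ} (h : Fin t → X × Y) : Fin t → Y := fun i => (h i).2

@[simp]
theorem seenMessages_snoc {t : ℕ} (h : Fin t → X × Y) (x : X) (y : Y) :
    seenMessages (Fin.snoc h (x, y) : Fin (t + 1) → X × Y) =
      (Fin.snoc (seenMessages h) y : Fin (t + 1) → Y) := by
  funext i
  induction i using Fin.lastCases <;> simp [seenMessages]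

@[simp]
theorem seenByAlgorithm_snoc {t : ℕ} (h : Fin t → Round X Y) (ρ : Round X Y) :
    seenByAlgorithm (Fin.snoc h ρ : Fin (t + 1) → Round X Y) =
      (Fin.snoc (seenByAlgorithm h) (ρ.1.1, ρ.2) : Fin (t + 1) → X × Y) := by
  funext i
  induction i using Fin.lastCases <;> simp [seenByAlgorithm]

variable [MeasurableSpace Y] {T : ℕ}

instance isMarkovKernel_query (π : Algorithm X Y T) (t : ℕ) : IsMarkovKernel (π.query t) :=
  π.isMarkov_query t

instance isMarkovKernel_output (π : Algorithm X Y T) : IsMarkovKernel π.output :=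
  π.isMarkov_output

/-- The oracle whose answers are independent with law `P`, whatever the queries. -/
def iidOracle (X : Set (Pt d)) (P : Measure (Pt d)) [IsProbabilityMeasure P] : Oracle X where
  answer _ := Kernel.const _ P
  isMarkov _ := inferInstance

theorem measurable_seenMessages {t : ℕ} :
    Measurable (seenMessages : (Fin t → X × Y) → _) := by
  unfold seenMessages; fun_prop

theorem measurable_snoc_prodMk (t : ℕ) (y : Y) :
    Measurable fun a : (Fin t → X × Y) × X =>
      (Fin.snoc a.1 (a.2, y) : Fin (t + 1) → X × Y) :=
  (measurable_snoc t).comp (measurable_fst.prodMk (measurable_snd.prodMk measurable_const))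

variable [Fintype Y]

/-- The reference measure on transcripts: queries are made by the algorithm, and messages are
distributed according to the counting measure. -/
def refLaw (q : ∀ t : ℕ, Kernel (Fin t → X × Y) X) : ∀ t : ℕ, Measure (Fin t → X × Y)
  | 0 => Measure.dirac Fin.elim0
  | t + 1 => ∑ y, (refLaw q t ⊗ₘ q t).map
      fun a => (Fin.snoc a.1 (a.2, y) : Fin (t + 1) → X × Y)

instance isFiniteMeasure_refLaw (q : ∀ t : ℕ, Kernel (Fin t → X × Y) X)
    [∀ t, IsMarkovKernel (q t)] (t : ℕ) : IsFiniteMeasure (refLaw q t) := by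
  induction t with
  | zero => rw [refLaw]; infer_instance
  | succ t ih => rw [refLaw]; infer_instance

theorem lintegral_refLaw_succ (q : ∀ t : ℕ, Kernel (Fin t → X × Y) X)
    [∀ t, IsMarkovKernel (q t)] (t : ℕ) {F : (Fin (t + 1) → X × Y) → ℝ≥0∞}
    (hF : Measurable F) :
    ∫⁻ h, F h ∂refLaw q (t + 1) =
      ∫⁻ h, ∑ y, ∫⁻ x, F (Fin.snoc h (x, y) : Fin (t + 1) → X × Y) ∂q t h ∂refLaw q t := by
  have hm : ∀ y, Measurable fun a : (Fin t → X × Y) × X =>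
      F (Fin.snoc a.1 (a.2, y) : Fin (t + 1) → X × Y) :=
    fun y => hF.comp (measurable_snoc_prodMk t y)
  rw [refLaw, lintegral_finsetSum_measure, lintegral_finsetSum]
  · refine Finset.sum_congr rfl fun y _ => ?_
    rw [lintegral_map hF (measurable_snoc_prodMk t y), Measure.lintegral_compProd (hm y)]
  · exact fun y _ => (hm y).lintegral_kernel_prod_right'

variable [MeasurableSingletonClass Y]

/-- The query kernels are Markov and integrate out, leaving counting measure on the messages. -/
theorem lintegral_seenMessages_refLaw (q : ∀ t : ℕ, Kernel (Fin t → X × Y) X)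
    [∀ t, IsMarkovKernel (q t)] (t : ℕ) (F : (Fin t → Y) → ℝ≥0∞) :
    ∫⁻ h, F (seenMessages h) ∂refLaw q t = ∑ m, F m := by
  induction t with
  | zero =>
    have hF : Measurable fun h : Fin 0 → X × Y => F (seenMessages h) :=
      (measurable_of_finite F).comp measurable_seenMessages
    rw [refLaw, lintegral_dirac' _ hF]
    simp [Subsingleton.elim (seenMessages _) default]
  | succ t ih =>
    have hF : Measurable fun h : Fin (t + 1) → X × Y => F (seenMessages h) :=
      (measurable_of_finite F).comp measurable_seenMessages
    rw [lintegral_refLaw_succ _ _ hF, sum_fin_succ_fun, ← ih]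
    simp

variable {𝒲 : Set (Channel d Y)}

/-- The channel selected after the messages `m`. -/
def Strategy.channel (S : Strategy 𝒲) (t : ℕ) (m : Fin t → Y) : Kernel (Pt d) Y := (S t m).1.1

instance isMarkovKernel_channel (S : Strategy 𝒲) (t : ℕ) (m : Fin t → Y) :
    IsMarkovKernel (S.channel t m) := (S t m).1.2

instance isMarkovKernel_channelStep (S : Strategy 𝒲) (t : ℕ) :
    IsMarkovKernel (channelStep (X := X) S t) :=
  ⟨fun a => (isMarkovKernel_channel S t (messages a.1)).isProbabilityMeasure _⟩

theorem lintegral_roundKernel (P : Measure (Pt d)) [IsProbabilityMeasure P]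
    (π : Algorithm X Y T) (S : Strategy 𝒲) (t : ℕ) (h : Fin t → Round X Y)
    {F : X × Y → ℝ≥0∞} (hF : Measurable F) :
    ∫⁻ ρ, F (ρ.1.1, ρ.2) ∂roundKernel (iidOracle X P) π S t h =
      ∑ y, ∫⁻ x, F (x, y) * ∫⁻ g, S.channel t (messages h) g {y} ∂P ∂π.query t (seenByAlgorithm h) := by
  have := (iidOracle X P).isMarkov t
  have hmy : ∀ y, Measurable fun g : Pt d => S.channel t (messages h) g {y} :=
    fun y => Kernel.measurable_coe _ (measurableSet_singleton y)
  have hFy : ∀ y, Measurable fun x : X => F (x, y) := fun y => hF.comp (by fun_prop)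
  have hF' : Measurable fun ρ : Round X Y => F (ρ.1.1, ρ.2) := hF.comp (by fun_prop)
  rw [roundKernel, Kernel.lintegral_compProd _ _ _ hF']
  have e : ∀ a : X × Pt d, ∫⁻ y, F (a.1, y) ∂channelStep S t (h, a) =
      ∑ y, F (a.1, y) * S.channel t (messages h) a.2 {y} := fun a => by
    rw [lintegral_fintype]; rfl
  simp only [e]
  have hsum : Measurable fun a : X × Pt d =>
      ∑ y, F (a.1, y) * S.channel t (messages h) a.2 {y} :=
    Finset.measurable_fun_sum _ fun y _ =>
      ((hFy y).comp measurable_fst).mul ((hmy y).comp measurable_snd)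
  rw [Kernel.lintegral_compProd _ _ _ hsum]
  have e2 : ∀ x : X, ∫⁻ g, ∑ y, F (x, y) * S.channel t (messages h) g {y}
      ∂(((iidOracle X P).answer t).comap (Prod.map seenByOracle id)
        (measurable_seenByOracle.prodMap measurable_id)) (h, x) =
      ∑ y, F (x, y) * ∫⁻ g, S.channel t (messages h) g {y} ∂P := fun x => by
    simp only [Kernel.comap_apply, iidOracle, Kernel.const_apply]
    rw [lintegral_finsetSum _ fun y _ => (hmy y).const_mul _]
    exact Finset.sum_congr rfl fun y _ => lintegral_const_mul _ (hmy y)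
  simp only [e2]
  rw [Kernel.comap_apply, lintegral_finsetSum _ fun y _ => (hFy y).mul_const _]

instance isMarkovKernel_roundKernel (P : Measure (Pt d)) [IsProbabilityMeasure P]
    (π : Algorithm X Y T) (S : Strategy 𝒲) (t : ℕ) :
    IsMarkovKernel (roundKernel (iidOracle X P) π S t) := by
  have := (iidOracle X P).isMarkov t
  rw [roundKernel]
  infer_instance

instance isProbabilityMeasure_law (P : Measure (Pt d)) [IsProbabilityMeasure P]
    (π : Algorithm X Y T) (S : Strategy 𝒲) (t : ℕ) :
    IsProbabilityMeasure (law (iidOracle X P) π S t) := by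
  induction t with
  | zero => rw [law]; infer_instance
  | succ t ih =>
    rw [law]
    exact Measure.isProbabilityMeasure_map (measurable_snoc t).aemeasurable

/-- For an oracle with i.i.d. answers, the transcript seen by the algorithm has the likelihood of
its messages as density with respect to the reference measure. -/
theorem map_seenByAlgorithm_law (P : Measure (Pt d)) [IsProbabilityMeasure P]
    (π : Algorithm X Y T) (S : Strategy 𝒲) {pr : ∀ t : ℕ, (Fin t → Y) → Y → ℝ}
    (h0 : ∀ t m y, 0 ≤ pr t m y)
    (hpr : ∀ t m y, ∫⁻ g, S.channel t m g {y} ∂P = ENNReal.ofReal (pr t m y)) (t : ℕ) :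
    (law (iidOracle X P) π S t).map seenByAlgorithm =
      (refLaw π.query t).withDensity
        fun h => ENNReal.ofReal (likelihood pr t (seenMessages h)) := by
  have hℓ : ∀ t, Measurable fun h : Fin t → X × Y =>
      ENNReal.ofReal (likelihood pr t (seenMessages h)) := fun t =>
    (measurable_of_finite fun m : Fin t → Y => ENNReal.ofReal (likelihood pr t m)).comp
      measurable_seenMessages
  induction t with
  | zero =>
    rw [law, refLaw, Measure.map_dirac' measurable_seenByAlgorithm]
    simp only [likelihood_zero, ENNReal.ofReal_one]
    rw [show (fun _ : Fin 0 → X × Y => (1 : ℝ≥0∞)) = 1 from rfl, withDensity_one]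
    congr 1
    exact Subsingleton.elim _ _
  | succ t ih =>
    refine Measure.ext_of_lintegral _ fun F hF => ?_
    have hFs : Measurable fun h : Fin (t + 1) → Round X Y => F (seenByAlgorithm h) :=
      hF.comp measurable_seenByAlgorithm
    have hFs' : Measurable fun a : (Fin t → Round X Y) × Round X Y =>
        F (seenByAlgorithm (Fin.snoc a.1 a.2 : Fin (t + 1) → Round X Y)) :=
      hFs.comp (measurable_snoc t)
    rw [lintegral_map hF measurable_seenByAlgorithm, law, lintegral_map hFs (measurable_snoc t),
      Measure.lintegral_compProd hFs',
      lintegral_withDensity_eq_lintegral_mul _ (hℓ _) hF,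
      lintegral_refLaw_succ _ _ ((hℓ _).mul hF)]
    have hsn : ∀ h : Fin t → X × Y, Measurable fun a : X × Y =>
        F (Fin.snoc h a : Fin (t + 1) → X × Y) := fun h =>
      hF.comp ((measurable_snoc t).comp (measurable_const.prodMk measurable_id))
    have hsy : ∀ y, Measurable fun a : (Fin t → X × Y) × X =>
      F (Fin.snoc a.1 (a.2, y) : Fin (t + 1) → X × Y) :=
      fun y => hF.comp (measurable_snoc_prodMk t y)
    have hcy : ∀ y, Measurable fun h : Fin t → X × Y =>
        ENNReal.ofReal (pr t (seenMessages h) y) := fun y =>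
      (measurable_of_finite fun m : Fin t → Y => ENNReal.ofReal (pr t m y)).comp
        measurable_seenMessages
    -- The integral of the test function over one further round, as a function of what the algorithm
    -- has seen; this allows the induction hypothesis to be applied.
    let H : (Fin t → X × Y) → ℝ≥0∞ := fun h => ∑ y, ∫⁻ x,
      F (Fin.snoc h (x, y) : Fin (t + 1) → X × Y) * ENNReal.ofReal (pr t (seenMessages h) y)
        ∂π.query t h
    have hH : Measurable H := by
      refine Finset.measurable_fun_sum _ fun y _ => ?_
      exact Measurable.lintegral_kernel_prod_right'
        (f := fun a : (Fin t → X × Y) × X => F (Fin.snoc a.1 (a.2, y) : Fin (t + 1) → X × Y) *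
          ENNReal.ofReal (pr t (seenMessages a.1) y))
        ((hsy y).mul ((hcy y).comp measurable_fst))
    have e1 : ∀ h : Fin t → Round X Y,
        ∫⁻ ρ, F (seenByAlgorithm (Fin.snoc h ρ : Fin (t + 1) → Round X Y))
          ∂roundKernel (iidOracle X P) π S t h = H (seenByAlgorithm h) := fun h => by
      simp only [seenByAlgorithm_snoc]
      rw [lintegral_roundKernel P π S t h (hsn (seenByAlgorithm h))]
      simp only [hpr]
      rfl
    simp only [e1]
    rw [← lintegral_map hH measurable_seenByAlgorithm, ih,
      lintegral_withDensity_eq_lintegral_mul _ (hℓ _) hH]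
    refine lintegral_congr fun h => ?_
    simp only [Pi.mul_apply, H, Finset.mul_sum, seenMessages_snoc, likelihood_snoc]
    refine Finset.sum_congr rfl fun y _ => ?_
    have hx : Measurable fun x : X => F (Fin.snoc h (x, y) : Fin (t + 1) → X × Y) :=
      (hsn h).comp (by fun_prop : Measurable fun x : X => (x, y))
    rw [← lintegral_const_mul _ (hx.mul_const _)]
    refine lintegral_congr fun x => ?_
    rw [ENNReal.ofReal_mul (likelihood_nonneg h0 _ _)]
    ring

end Transcript

/-! ### Assouad's method for linear functions on a cube -/

section Assouad

variable {d : ℕ}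

/-- The cube of half side length `b`. -/
def cube (d : ℕ) (b : ℝ) : Set (Pt d) := {x | ∀ i, |x i| ≤ b}

theorem convex_cube (d : ℕ) (b : ℝ) : Convex ℝ (cube d b) := by
  intro x hx y hy s t hs ht hst i
  calc |s * x i + t * y i| ≤ |s * x i| + |t * y i| := abs_add_le _ _
    _ = s * |x i| + t * |y i| := by rw [abs_mul, abs_mul, abs_of_nonneg hs, abs_of_nonneg ht]
    _ ≤ s * b + t * b := by gcongr; exacts [hx i, hy i]
    _ = b := by rw [← add_mul, hst, one_mul]

/-- The linear function with slope `± c` in each coordinate. -/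
def signedLinear (c : ℝ) (v : Fin d → Bool) (x : Pt d) : ℝ := ∑ i, c * sgn (v i) * x i

theorem signedLinear_add (c : ℝ) (v : Fin d → Bool) (x y : Pt d) :
    signedLinear c v (x + y) = signedLinear c v x + signedLinear c v y := by
  simp [signedLinear, mul_add, Finset.sum_add_distrib]

theorem signedLinear_smul (c : ℝ) (v : Fin d → Bool) (a : ℝ) (x : Pt d) :
    signedLinear c v (a • x) = a * signedLinear c v x := by
  simp only [signedLinear, Pi.smul_apply, smul_eq_mul, Finset.mul_sum]
  exact Finset.sum_congr rfl fun i _ => by ring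

theorem iInf_signedLinear_le {b c : ℝ} (hb : 0 ≤ b) (hc : 0 ≤ c) (v : Fin d → Bool) :
    ⨅ z : cube d b, signedLinear c v z ≤ -(c * b * d) := by
  have hz : (fun i => -(b * sgn (v i))) ∈ cube d b := fun i => by
    simp [abs_mul, abs_sgn, abs_of_nonneg hb]
  -- An infimum of reals that is not bounded below would have the default value 0, so boundedness
  -- has to be checked.
  have hbdd : BddBelow (Set.range fun z : cube d b => signedLinear c v z) := by
    refine ⟨∑ _i : Fin d, -(c * b), ?_⟩
    rintro _ ⟨z, rfl⟩
    refine Finset.sum_le_sum fun i _ => ?_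
    have h1 : |c * sgn (v i) * z.1 i| ≤ c * b := by
      rw [abs_mul, abs_mul, abs_sgn, abs_of_nonneg hc, mul_one]
      exact mul_le_mul_of_nonneg_left (z.2 i) hc
    exact (abs_le.1 h1).1
  refine (ciInf_le hbdd ⟨_, hz⟩).trans (le_of_eq ?_)
  have : ∀ i, c * sgn (v i) * -(b * sgn (v i)) = -(c * b) := fun i => by
    linear_combination (-(c * b)) * sgn_mul_self (v i)
  simp only [signedLinear, this]
  simp [mul_comm]

/-- A signed linear function, with i.i.d. bounded answers whose mean is its slope, belongs to the
convex class on the cube. -/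
theorem mem_convexClass {Ω : Type} [Fintype Ω] {μ : Ω → ℝ} {G : Ω → Pt d}
    [IsProbabilityMeasure (discreteLaw μ G)] (h0 : ∀ ω, 0 ≤ μ ω)
    {p : ℝ≥0∞} {B b c : ℝ} {v : Fin d → Bool}
    (hmean : ∀ i, ∑ ω, μ ω * G ω i = c * sgn (v i))
    (hG : ∀ ω, pNorm p.conjExponent (G ω) ^ 2 ≤ B ^ 2) :
    (signedLinear c v, iidOracle (cube d b) (discreteLaw μ G)) ∈ convexClass p B (cube d b) := by
  refine ⟨⟨convex_cube d b, fun x _ y _ s t _ _ _ => le_of_eq ?_⟩, fun t h x => ⟨?_, ?_⟩⟩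
  · simp only [signedLinear_add, signedLinear_smul, smul_eq_mul]
  · intro y _
    have e : ∫ g, g ∂((iidOracle (cube d b) (discreteLaw μ G)).answer t (h, x)) =
        fun i => c * sgn (v i) := by
      simp only [iidOracle, Kernel.const_apply]
      rw [integral_discreteLaw G h0]
      funext i
      simp [Finset.sum_apply, hmean]
    have e' : (fun i => c * sgn (v i)) ⬝ᵥ (y - x.1) = signedLinear c v (y - x.1) := rfl
    simp only [e, e']
    rw [← signedLinear_add, add_sub_cancel]
  · exact ae_discreteLaw hG

variable {Y : Type} [MeasurableSpace Y] {T : ℕ} {b : ℝ}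

theorem integrable_coord_cube (ν : Measure (cube d b)) [IsFiniteMeasure ν] (i : Fin d) :
    Integrable (fun x : cube d b => x.1 i) ν :=
  Integrable.of_bound ((measurable_pi_apply i).comp measurable_subtype_coe).aestronglyMeasurable b
    (.of_forall fun x => x.2 i)

/-- The mean of a coordinate of the returned point, given what the algorithm has seen. -/
def outputMean (π : Algorithm (cube d b) Y T) (i : Fin d) (h : Fin T → cube d b × Y) : ℝ :=
  ∫ x, x.1 i ∂π.output h

theorem abs_outputMean_le (π : Algorithm (cube d b) Y T) (i : Fin d)
    (h : Fin T → cube d b × Y) : |outputMean π i h| ≤ b := by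
  have := norm_integral_le_of_norm_le_const (μ := π.output h) (f := fun x : cube d b => x.1 i)
    (C := b) (.of_forall fun x => x.2 i)
  simpa [outputMean] using this

theorem measurable_outputMean (π : Algorithm (cube d b) Y T) (i : Fin d) :
    Measurable (outputMean π i) :=
  (StronglyMeasurable.integral_kernel (κ := π.output)
    ((measurable_pi_apply i).comp measurable_subtype_coe).stronglyMeasurable).measurable

variable [Fintype Y] [MeasurableSingletonClass Y] {𝒲 : Set (Channel d Y)}

instance isProbabilityMeasure_outputLaw {X : Set (Pt d)} (P : Measure (Pt d))
    [IsProbabilityMeasure P] (π : Algorithm X Y T) (S : Strategy 𝒲) :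
    IsProbabilityMeasure (outputLaw (iidOracle X P) π S) := by
  have : IsProbabilityMeasure ((law (iidOracle X P) π S T).map seenByAlgorithm) :=
    Measure.isProbabilityMeasure_map measurable_seenByAlgorithm.aemeasurable
  rw [outputLaw]
  infer_instance

theorem measurable_likelihood_seenMessages {X : Set (Pt d)} (pr : ∀ t : ℕ, (Fin t → Y) → Y → ℝ)
    (t : ℕ) : Measurable fun h : Fin t → X × Y => likelihood pr t (seenMessages h) :=
  (measurable_of_finite (likelihood pr t)).comp measurable_seenMessages

theorem integrable_outputMean_mul (π : Algorithm (cube d b) Y T) (i : Fin d)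
    (pr : ∀ t : ℕ, (Fin t → Y) → Y → ℝ) :
    Integrable (fun h => likelihood pr T (seenMessages h) * outputMean π i h)
      (refLaw π.query T) := by
  refine Integrable.of_bound ((measurable_likelihood_seenMessages pr T).mul
    (measurable_outputMean π i)).aestronglyMeasurable ((∑ m, |likelihood pr T m|) * b)
    (.of_forall fun h => ?_)
  rw [Real.norm_eq_abs, abs_mul]
  refine mul_le_mul ?_ (abs_outputMean_le π i h) (abs_nonneg _)
    (Finset.sum_nonneg fun _ _ => abs_nonneg _)
  exact Finset.single_le_sum (f := fun m => |likelihood pr T m|) (fun _ _ => abs_nonneg _)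
    (Finset.mem_univ _)

/-- Conditioning on the transcript puts all dependence on the oracle into the likelihood;
`outputMean` and the reference measure involve only the algorithm. -/
theorem integral_coord_outputLaw (P : Measure (Pt d)) [IsProbabilityMeasure P]
    (π : Algorithm (cube d b) Y T) (S : Strategy 𝒲) {pr : ∀ t : ℕ, (Fin t → Y) → Y → ℝ}
    (h0 : ∀ t m y, 0 ≤ pr t m y)
    (hpr : ∀ t m y, ∫⁻ g, S.channel t m g {y} ∂P = ENNReal.ofReal (pr t m y)) (i : Fin d) :
    ∫ x, x.1 i ∂outputLaw (iidOracle (cube d b) P) π S =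
      ∫ h, likelihood pr T (seenMessages h) * outputMean π i h ∂refLaw π.query T := by
  have hm : Measurable fun h : Fin T → cube d b × Y =>
      (likelihood pr T (seenMessages h)).toNNReal :=
    (measurable_likelihood_seenMessages pr T).real_toNNReal
  have hint := integrable_coord_cube (outputLaw (iidOracle (cube d b) P) π S) i
  rw [outputLaw] at hint ⊢
  rw [Measure.comp_eq_comp_const_apply] at hint ⊢
  rw [Kernel.integral_comp hint, Kernel.const_apply, map_seenByAlgorithm_law P π S h0 hpr]
  simp only [ENNReal.ofReal]
  rw [integral_withDensity_eq_integral_smul hm]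
  refine integral_congr_ae (.of_forall fun h => ?_)
  simp only [NNReal.smul_def, smul_eq_mul, outputMean]
  rw [Real.coe_toNNReal _ (likelihood_nonneg h0 _ _)]

theorem integral_seenMessages_refLaw {X : Set (Pt d)} (q : ∀ t : ℕ, Kernel (Fin t → X × Y) X)
    [∀ t, IsMarkovKernel (q t)] (t : ℕ) {F : (Fin t → Y) → ℝ} (hF : ∀ m, 0 ≤ F m) :
    ∫ h, F (seenMessages h) ∂refLaw q t = ∑ m, F m := by
  rw [integral_eq_lintegral_of_nonneg_ae (.of_forall fun h => hF _)
    ((measurable_of_finite F).comp measurable_seenMessages).aestronglyMeasurable,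
    lintegral_seenMessages_refLaw q t fun m => ENNReal.ofReal (F m),
    ← ENNReal.ofReal_sum_of_nonneg fun m _ => hF m,
    ENNReal.toReal_ofReal (Finset.sum_nonneg fun m _ => hF m)]

/-- Both integrals have the same integrand up to the likelihood, and `|outputMean| ≤ b`; the
remaining integral depends on messages only and becomes a finite sum. -/
theorem abs_integral_sub_le (π : Algorithm (cube d b) Y T) (i : Fin d)
    (p q : ∀ t : ℕ, (Fin t → Y) → Y → ℝ) :
    |(∫ h, likelihood p T (seenMessages h) * outputMean π i h ∂refLaw π.query T) -
      ∫ h, likelihood q T (seenMessages h) * outputMean π i h ∂refLaw π.query T| ≤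
      b * ∑ m, |likelihood p T m - likelihood q T m| := by
  rw [← integral_sub (integrable_outputMean_mul π i p) (integrable_outputMean_mul π i q),
    ← integral_seenMessages_refLaw π.query T
      (F := fun m => |likelihood p T m - likelihood q T m|) (fun m => abs_nonneg _),
    ← integral_const_mul]
  refine norm_integral_le_of_norm_le (f := fun h => likelihood p T (seenMessages h) *
    outputMean π i h - likelihood q T (seenMessages h) * outputMean π i h) ?_
    (.of_forall fun h => ?_)
  · refine Integrable.of_bound (((measurable_of_finite fun m : Fin T → Y =>
      |likelihood p T m - likelihood q T m|).comp measurable_seenMessages).const_mul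
        b).aestronglyMeasurable
      (|b| * ∑ m, |likelihood p T m - likelihood q T m|) (.of_forall fun h => ?_)
    rw [norm_mul, Real.norm_eq_abs, Real.norm_eq_abs, abs_abs]
    gcongr
    exact Finset.single_le_sum (f := fun m => |likelihood p T m - likelihood q T m|)
      (fun _ _ => abs_nonneg _) (Finset.mem_univ _)
  · rw [← sub_mul, Real.norm_eq_abs, abs_mul, mul_comm]
    gcongr
    exact abs_outputMean_le π i h

theorem le_error_signedLinear {c : ℝ} (hb : 0 ≤ b) (hc : 0 ≤ c) (v : Fin d → Bool)
    (P : Measure (Pt d)) [IsProbabilityMeasure P]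
    (π : Algorithm (cube d b) Y T) (S : Strategy 𝒲) :
    c * b * d - c * ∑ i, -sgn (v i) * ∫ x, x.1 i ∂outputLaw (iidOracle (cube d b) P) π S ≤
      error (signedLinear c v) (iidOracle (cube d b) P) π S := by
  have hi := fun i => (integrable_coord_cube (outputLaw (iidOracle (cube d b) P) π S) i).const_mul
    (c * sgn (v i))
  have e : ∫ x : cube d b, signedLinear c v x ∂outputLaw (iidOracle (cube d b) P) π S =
      -(c * ∑ i, -sgn (v i) * ∫ x, x.1 i ∂outputLaw (iidOracle (cube d b) P) π S) := by
    simp only [signedLinear]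
    rw [integral_finsetSum _ fun i _ => hi i, Finset.mul_sum, ← Finset.sum_neg_distrib]
    refine Finset.sum_congr rfl fun i _ => ?_
    rw [integral_const_mul]
    ring
  have hint : Integrable (fun x : cube d b => signedLinear c v x)
      (outputLaw (iidOracle (cube d b) P) π S) := integrable_finsetSum _ fun i _ => hi i
  rw [error, integral_sub hint (integrable_const _), e, integral_const]
  simp only [probReal_univ, one_smul]
  linarith [iInf_signedLinear_le hb hc v]

/-- Pairing `v` with `flip v i`, where the sign is opposite, turns the sum over `v` into half a sum
of signed differences of `E`. An average of at most `C` is then attained or undercut by some vertex.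
-/
theorem exists_sum_le {E : (Fin d → Bool) → Fin d → ℝ} {δ : (Fin d → Bool) → Fin d → ℝ} {C : ℝ}
    (hE : ∀ v i, |E v i - E (flip v i) i| ≤ δ v i) (hδ : ∑ v, ∑ i, δ v i / 2 ≤ 2 ^ d * C) :
    ∃ v, ∑ i, -sgn (v i) * E v i ≤ C := by
  have key : ∑ v, ∑ i, -sgn (v i) * E v i ≤ ∑ v, ∑ i, δ v i / 2 := by
    rw [Finset.sum_comm]
    conv_rhs => rw [Finset.sum_comm]
    refine Finset.sum_le_sum fun i _ => ?_
    have h2 : ∑ v, -sgn (v i) * E v i = ∑ v, -sgn (v i) * (E v i - E (flip v i) i) / 2 := by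
      have h3 := sum_flip i fun v => -sgn (v i) * E v i
      simp only [flip_same, sgn_not, neg_neg] at h3
      rw [← Finset.sum_div, eq_div_iff two_ne_zero]
      simp only [mul_sub, Finset.sum_sub_distrib, neg_mul, Finset.sum_neg_distrib] at h3 ⊢
      linarith
    rw [h2]
    refine Finset.sum_le_sum fun v _ => ?_
    gcongr
    refine (le_abs_self _).trans ?_
    rw [abs_mul, abs_neg, abs_sgn, one_mul]
    exact hE v i
  obtain ⟨v, -, hv⟩ := Finset.exists_le_of_sum_le (s := (Finset.univ : Finset (Fin d → Bool)))
    (f := fun v => ∑ i, -sgn (v i) * E v i) (g := fun _ => C) Finset.univ_nonempty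
    (by simpa using key.trans hδ)
  exact ⟨v, hv⟩

/-- The lower bound on the minmax error by a family of linear functions indexed by the vertices of a
cube, with oracles such that no channel tells neighbouring vertices apart. -/
theorem le_minmaxError {Ω : Type} [Fintype Ω] {μ : (Fin d → Bool) → Ω → ℝ} {G : Ω → Pt d}
    (h0 : ∀ v ω, 0 ≤ μ v ω) (h1 : ∀ v, ∑ ω, μ v ω = 1) {p : ℝ≥0∞} {B c β : ℝ}
    (hb : 0 ≤ b) (hc : 0 ≤ c)
    (hmean : ∀ v i, ∑ ω, μ v ω * G ω i = c * sgn (v i))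
    (hG : ∀ ω, pNorm p.conjExponent (G ω) ^ 2 ≤ B ^ 2)
    (hβ : ∀ w : Ω → Y → ℝ, (∀ ω y, 0 ≤ w ω y) → (∀ ω, ∑ y, w ω y = 1) → ∀ v,
      ∑ i, sqHellinger (fun y => ∑ ω, μ v ω * w ω y) (fun y => ∑ ω, μ (flip v i) ω * w ω y) ≤ β)
    (hT : T * β ≤ d / 4) :
    ((c * b * d / 2 : ℝ) : EReal) ≤
      minmaxError (cube d b) (convexClass p B (cube d b)) T 𝒲 := by
  refine le_iInf fun π => le_iInf fun S => ?_
  have hP := fun v => isProbabilityMeasure_discreteLaw G (h0 v) (h1 v)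
  -- Only the rows of the channel at the finitely many possible answers matter; they form a
  -- stochastic matrix, to which `hβ` applies.
  let w : ∀ t : ℕ, (Fin t → Y) → Ω → Y → ℝ := fun t m ω y => (S.channel t m (G ω)).real {y}
  have hw0 : ∀ t m ω y, 0 ≤ w t m ω y := fun t m ω y => measureReal_nonneg
  have hw1 : ∀ t m ω, ∑ y, w t m ω y = 1 := fun t m ω =>
    (sum_measureReal_singleton (μ := S.channel t m (G ω)) Finset.univ).trans (by simp)
  let pr : (Fin d → Bool) → ∀ t : ℕ, (Fin t → Y) → Y → ℝ :=
    fun v t m y => ∑ ω, μ v ω * w t m ω y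
  have hpr0 : ∀ v t m y, 0 ≤ pr v t m y := fun v t m y =>
    Finset.sum_nonneg fun ω _ => mul_nonneg (h0 v ω) (hw0 t m ω y)
  have hpr1 : ∀ v t m, ∑ y, pr v t m y = 1 := fun v t m => by
    simp only [pr]
    rw [Finset.sum_comm]
    simp [← Finset.mul_sum, hw1, h1]
  have hpr : ∀ v t m y, ∫⁻ g, S.channel t m g {y} ∂discreteLaw (μ v) G =
      ENNReal.ofReal (pr v t m y) := fun v t m y => by
    rw [discreteLaw, lintegral_finsetSum_measure,
      ENNReal.ofReal_sum_of_nonneg fun ω _ => mul_nonneg (h0 v ω) (hw0 t m ω y)]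
    refine Finset.sum_congr rfl fun ω _ => ?_
    rw [lintegral_smul_measure, lintegral_dirac, ENNReal.ofReal_mul (h0 v ω)]
    simp [w]
  let E : (Fin d → Bool) → Fin d → ℝ := fun v i =>
    ∫ x, x.1 i ∂outputLaw (iidOracle (cube d b) (discreteLaw (μ v) G)) π S
  have hE : ∀ v i, |E v i - E (flip v i) i| ≤
      b * ∑ m, |likelihood (pr v) T m - likelihood (pr (flip v i)) T m| := fun v i => by
    simp only [E]
    rw [integral_coord_outputLaw _ π S (hpr0 v) (hpr v) i,
      integral_coord_outputLaw _ π S (hpr0 (flip v i)) (hpr (flip v i)) i]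
    exact abs_integral_sub_le π i _ _
  -- Half of the maximal value `b * d` of the correlation with the wrong signs, because the average
  -- total variation distance is at most 1/2.
  obtain ⟨v, hv⟩ := exists_sum_le (C := b * (d / 2)) hE (by
      have := sum_half_sum_abs_likelihood_sub_le hpr0 hpr1
        (fun v t m => hβ (w t m) (hw0 t m) (hw1 t m) v) T hT
      have := mul_le_mul_of_nonneg_left this hb
      simp only [mul_div_assoc, ← Finset.mul_sum] at this ⊢
      linarith)
  have hmem := mem_convexClass (b := b) (h0 v) (hmean v) hG
  have herr : c * b * d / 2 ≤
      error (signedLinear c v) (iidOracle (cube d b) (discreteLaw (μ v) G)) π S := by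
    have h2 := mul_le_mul_of_nonneg_left hv hc
    refine le_trans ?_ (le_error_signedLinear hb hc v (discreteLaw (μ v) G) π S)
    linarith
  exact (EReal.coe_le_coe_iff.2 herr).trans
    (le_iSup₂_of_le (f := fun fO (_ : fO ∈ convexClass p B (cube d b)) =>
      ((error fO.1 fO.2 π S : ℝ) : EReal)) _ hmem le_rfl)

end Assouad

/-- Factor `p - q = (√p - √q)(√p + √q)` and use `(√p + √q)² ≥ p + q`. The product form avoids
dividing by a message probability that may vanish. -/
theorem sq_sqrt_sub_sqrt_mul_le {p q a : ℝ} (hp : 0 ≤ p) (hq : 0 ≤ q) (ha : a ≤ p + q) :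
    (√p - √q) ^ 2 * a ≤ (p - q) ^ 2 := by
  have h : (p - q) ^ 2 = (√p - √q) ^ 2 * (√p + √q) ^ 2 := by
    have e : p - q = (√p - √q) * (√p + √q) := by
      linear_combination -Real.sq_sqrt hp + Real.sq_sqrt hq
    rw [← mul_pow, ← e]
  rw [h]
  refine mul_le_mul_of_nonneg_left (ha.trans ?_) (sq_nonneg _)
  nlinarith [Real.sq_sqrt hp, Real.sq_sqrt hq, mul_nonneg (Real.sqrt_nonneg p) (Real.sqrt_nonneg q)]

/-! ### One random coordinate with a biased sign -/

section Sparse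

variable {d : ℕ}

/-- The probability mass function of a uniformly random coordinate together with a slightly biased
sign. -/
def sparseMass (δ : ℝ) (v : Fin d → Bool) (ω : Fin d × Bool) : ℝ :=
  (1 + δ * (sgn (v ω.1) * sgn ω.2)) / (2 * d)

theorem abs_mul_sgn_mul_sgn {δ : ℝ} (hδ : 0 ≤ δ) (a b : Bool) : |δ * (sgn a * sgn b)| = δ := by
  simp [abs_mul, abs_sgn, abs_of_nonneg hδ]

theorem sparseMass_nonneg {δ : ℝ} (hδ : 0 ≤ δ) (hδ1 : δ ≤ 1) (v : Fin d → Bool)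
    (ω : Fin d × Bool) : 0 ≤ sparseMass δ v ω := by
  have := (abs_le.1 (abs_mul_sgn_mul_sgn hδ (v ω.1) ω.2).le).1
  exact div_nonneg (by linarith) (by positivity)

theorem sum_sparseMass_mul (δ : ℝ) (v : Fin d → Bool) (f : Fin d × Bool → ℝ) :
    ∑ ω, sparseMass δ v ω * f ω =
      ∑ j, ((f (j, true) + f (j, false)) + δ * sgn (v j) * (f (j, true) - f (j, false))) /
        (2 * d) := by
  rw [Fintype.sum_prod_type]
  refine Finset.sum_congr rfl fun j _ => ?_
  simp only [sparseMass, Fintype.sum_bool, sgn_true, sgn_false]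
  ring

theorem sum_sparseMass (hd : 1 ≤ d) (δ : ℝ) (v : Fin d → Bool) : ∑ ω, sparseMass δ v ω = 1 := by
  have h := sum_sparseMass_mul δ v fun _ => 1
  have : (d : ℝ) ≠ 0 := by positivity
  simp only [mul_one, sub_self, mul_zero, add_zero, Finset.sum_const, Finset.card_univ,
    Fintype.card_fin, nsmul_eq_mul] at h
  rw [h]
  field_simp
  norm_num

/-- The signed and scaled basis vectors. -/
def sparseVector (B : ℝ) (ω : Fin d × Bool) : Pt d := Pi.single ω.1 (B * sgn ω.2)

theorem sum_sparseMass_mul_sparseVector (δ B : ℝ) (v : Fin d → Bool) (i : Fin d) :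
    ∑ ω, sparseMass δ v ω * sparseVector B ω i = B * δ / d * sgn (v i) := by
  rw [sum_sparseMass_mul δ v fun ω => sparseVector B ω i]
  rw [Finset.sum_eq_single i]
  · simp only [sparseVector, Pi.single_eq_same, sgn_true, sgn_false]
    rw [mul_comm 2 (d : ℝ), ← div_div]
    ring
  · intro j _ hj
    simp [sparseVector, Pi.single_eq_of_ne hj.symm]
  · simp

variable {Y : Type} [Fintype Y]

theorem sum_sqHellinger_sparse_le (hd : 1 ≤ d) {δ : ℝ} (hδ : 0 ≤ δ) (hδ1 : δ ≤ 1 / 2)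
    {w : Fin d × Bool → Y → ℝ} (hw0 : ∀ ω y, 0 ≤ w ω y) (hw1 : ∀ ω, ∑ y, w ω y = 1)
    (v : Fin d → Bool) :
    ∑ i, sqHellinger (fun y => ∑ ω, sparseMass δ v ω * w ω y)
        (fun y => ∑ ω, sparseMass δ (flip v i) ω * w ω y) ≤
      4 * δ ^ 2 * min (Fintype.card Y : ℝ) d / d := by
  have hd0 : (0 : ℝ) < d := by positivity
  have hwle : ∀ ω y, w ω y ≤ 1 := fun ω y => (hw1 ω) ▸
    Finset.single_le_sum (f := w ω) (fun y _ => hw0 ω y) (Finset.mem_univ y)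
  let A : Y → ℝ := fun y => ∑ ω, w ω y
  have hA0 : ∀ y, 0 ≤ A y := fun y => Finset.sum_nonneg fun ω _ => hw0 ω y
  have hAsum : ∑ y, A y = 2 * d := by
    simp only [A]
    rw [Finset.sum_comm]
    simp [hw1, mul_comm]
  have hAj : ∀ y, A y = ∑ j, (w (j, true) y + w (j, false) y) := fun y => by
    simp only [A]
    rw [Fintype.sum_prod_type]
    simp
  -- Since `δ ≤ 1/2`, every atom has mass at least `(1 - δ) / (2d) ≥ 1 / (4d)`.
  have hlow : ∀ (u : Fin d → Bool) y, A y / (4 * d) ≤ ∑ ω, sparseMass δ u ω * w ω y := by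
    intro u y
    simp only [A]
    rw [Finset.sum_div]
    refine Finset.sum_le_sum fun ω _ => ?_
    have := (abs_le.1 (abs_mul_sgn_mul_sgn hδ (u ω.1) ω.2).le).1
    have h2 : 1 / (4 * d) ≤ sparseMass δ u ω := by
      rw [sparseMass, div_le_div_iff₀ (by positivity) (by positivity)]
      nlinarith
    calc w ω y / (4 * d) = 1 / (4 * d) * w ω y := by ring
      _ ≤ _ := mul_le_mul_of_nonneg_right h2 (hw0 ω y)
  have hdiff : ∀ i y, (∑ ω, sparseMass δ v ω * w ω y) -
      ∑ ω, sparseMass δ (flip v i) ω * w ω y =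
        δ * sgn (v i) / d * (w (i, true) y - w (i, false) y) := by
    intro i y
    rw [sum_sparseMass_mul δ v fun ω => w ω y, sum_sparseMass_mul δ (flip v i) fun ω => w ω y,
      ← Finset.sum_sub_distrib, Finset.sum_eq_single i]
    · rw [flip_same, sgn_not, mul_comm 2 (d : ℝ), ← div_div, ← div_div]
      ring
    · intro j _ hj
      rw [flip_of_ne v hj, sub_self]
    · simp
  have hsq : ∀ i y, (√(∑ ω, sparseMass δ v ω * w ω y) -
      √(∑ ω, sparseMass δ (flip v i) ω * w ω y)) ^ 2 * A y ≤
        2 * δ ^ 2 / d * (w (i, true) y - w (i, false) y) ^ 2 := by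
    intro i y
    have hnn := div_nonneg (hA0 y) (by positivity : (0 : ℝ) ≤ 4 * d)
    have h := sq_sqrt_sub_sqrt_mul_le (a := A y / (2 * d)) (hnn.trans (hlow v y))
      (hnn.trans (hlow (flip v i) y))
      (by
        have := add_le_add (hlow v y) (hlow (flip v i) y)
        refine le_trans (le_of_eq ?_) this
        field_simp
        ring)
    rw [hdiff] at h
    have h' := mul_le_mul_of_nonneg_left h (by positivity : (0 : ℝ) ≤ 2 * d)
    have e1 : ∀ z : ℝ, 2 * (d : ℝ) * (z * (A y / (2 * d))) = z * A y := fun z => by field_simp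
    have e2 : 2 * (d : ℝ) * (δ * sgn (v i) / d * (w (i, true) y - w (i, false) y)) ^ 2 =
        2 * δ ^ 2 / d * (w (i, true) y - w (i, false) y) ^ 2 := by
      have := sgn_mul_self (v i)
      rw [mul_pow, div_pow, mul_pow, sq (sgn (v i)), this]
      field_simp
    rwa [e1, e2] at h'
  -- After multiplication by `A y`, one factor of each squared difference is bounded by `min 1 (A
  -- y)`, while the other is at most `w (i, true) y + w (i, false) y`, which sums over `i` to `A y`.
  have hY : ∀ y, ∑ i, (√(∑ ω, sparseMass δ v ω * w ω y) -
      √(∑ ω, sparseMass δ (flip v i) ω * w ω y)) ^ 2 ≤ 2 * δ ^ 2 / d * min 1 (A y) := by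
    intro y
    rcases (hA0 y).eq_or_lt with h | h
    · have hz : ∀ ω, w ω y = 0 := fun ω =>
        (Finset.sum_eq_zero_iff_of_nonneg fun ω _ => hw0 ω y).1 h.symm ω (Finset.mem_univ ω)
      simp [hz, ← h]
    · refine le_of_mul_le_mul_right ?_ h
      rw [Finset.sum_mul]
      refine (Finset.sum_le_sum fun i _ => hsq i y).trans ?_
      rw [← Finset.mul_sum, mul_assoc]
      refine mul_le_mul_of_nonneg_left ?_ (by positivity)
      have hmin : min 1 (A y) * A y = ∑ j, min 1 (A y) * (w (j, true) y + w (j, false) y) := by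
        rw [← Finset.mul_sum, ← hAj]
      rw [hmin]
      refine Finset.sum_le_sum fun i _ => ?_
      have a0 := hw0 (i, true) y
      have b0 := hw0 (i, false) y
      have a1 := hwle (i, true) y
      have b1 := hwle (i, false) y
      have hs : w (i, true) y + w (i, false) y ≤ A y := by
        rw [hAj]
        exact Finset.single_le_sum (f := fun j => w (j, true) y + w (j, false) y)
          (fun j _ => add_nonneg (hw0 _ y) (hw0 _ y)) (Finset.mem_univ i)
      have habs : |w (i, true) y - w (i, false) y| ≤ min 1 (A y) := by
        rw [abs_le]
        constructor
        · have := le_min b1 (by linarith : w (i, false) y ≤ A y)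
          linarith
        · have := le_min a1 (by linarith : w (i, true) y ≤ A y)
          linarith
      have habs' : |w (i, true) y - w (i, false) y| ≤ w (i, true) y + w (i, false) y := by
        rw [abs_le]
        constructor <;> linarith
      rw [← sq_abs, sq]
      exact mul_le_mul habs habs' (abs_nonneg _) ((abs_nonneg _).trans habs)
  simp only [sqHellinger]
  rw [Finset.sum_comm]
  refine (Finset.sum_le_sum fun y _ => hY y).trans ?_
  rw [← Finset.mul_sum]
  -- The bound 1 counts the messages; the bound `A y` sums to `2 * d`.
  have hfin : ∑ y, min 1 (A y) ≤ 2 * min (Fintype.card Y : ℝ) d := by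
    rw [mul_min_of_nonneg _ _ zero_le_two]
    refine le_min ?_ ?_
    · have := Finset.sum_le_sum fun (y : Y) (_ : y ∈ Finset.univ) => min_le_left 1 (A y)
      simp only [Finset.sum_const, Finset.card_univ, nsmul_eq_mul, mul_one] at this
      have h0 : (0 : ℝ) ≤ Fintype.card Y := Nat.cast_nonneg _
      linarith
    · rw [← hAsum]
      exact Finset.sum_le_sum fun y _ => min_le_right _ _
  calc _ ≤ 2 * δ ^ 2 / d * (2 * min (Fintype.card Y : ℝ) d) :=
        mul_le_mul_of_nonneg_left hfin (by positivity)
    _ = _ := by ring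

end Sparse

/-! ### Independent biased signs in all coordinates -/

section Dense

variable {d : ℕ}

/-- The probability mass function of independent slightly biased signs. -/
def denseMass (δ : ℝ) (v s : Fin d → Bool) : ℝ := ∏ i, (1 + δ * (sgn (v i) * sgn (s i))) / 2

theorem denseMass_nonneg {δ : ℝ} (hδ : 0 ≤ δ) (hδ1 : δ ≤ 1) (v s : Fin d → Bool) :
    0 ≤ denseMass δ v s :=
  Finset.prod_nonneg fun i _ => by
    have := (abs_le.1 (abs_mul_sgn_mul_sgn hδ (v i) (s i)).le).1
    linarith

theorem sum_denseMass_mul_prod (δ : ℝ) (v : Fin d → Bool) (f : Fin d → Bool → ℝ) :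
    ∑ s, denseMass δ v s * ∏ i, f i (s i) =
      ∏ i, (((1 + δ * sgn (v i)) / 2) * f i true + ((1 - δ * sgn (v i)) / 2) * f i false) := by
  have h := Finset.prod_univ_sum (fun _ : Fin d => (Finset.univ : Finset Bool))
    fun i b => (1 + δ * (sgn (v i) * sgn b)) / 2 * f i b
  rw [Fintype.piFinset_univ] at h
  simp only [denseMass, ← Finset.prod_mul_distrib]
  rw [← h]
  refine Finset.prod_congr rfl fun i _ => ?_
  simp only [Fintype.sum_bool, sgn_true, sgn_false]
  ring

theorem sum_denseMass (δ : ℝ) (v : Fin d → Bool) : ∑ s, denseMass δ v s = 1 := by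
  have h := sum_denseMass_mul_prod δ v fun _ _ => 1
  simp only [Finset.prod_const_one, mul_one] at h
  rw [h]
  exact Finset.prod_eq_one fun i _ => by ring

/-- The vectors with entries `± a`. -/
def denseVector (a : ℝ) (s : Fin d → Bool) : Pt d := fun i => a * sgn (s i)

theorem sum_denseMass_mul_denseVector (δ a : ℝ) (v : Fin d → Bool) (i : Fin d) :
    ∑ s, denseMass δ v s * denseVector a s i = a * δ * sgn (v i) := by
  -- Setting all factors but the `i`-th to 1 extracts the mean of one coordinate from the product
  -- formula.
  have h := sum_denseMass_mul_prod δ v fun j b => if j = i then a * sgn b else 1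
  have e : ∀ s : Fin d → Bool, (∏ j, if j = i then a * sgn (s j) else 1) = a * sgn (s i) :=
    fun s => by simp
  simp only [e] at h
  simp only [denseVector, h]
  rw [Finset.prod_eq_single i]
  · simp only [if_true, sgn_true, sgn_false]
    ring
  · intro j _ hj
    simp only [hj, if_false]
    ring
  · simp

/-- The centred sign of a coordinate under `denseMass δ v`. -/
def score (δ : ℝ) (v s : Fin d → Bool) (i : Fin d) : ℝ := sgn (v i) * sgn (s i) - δ

theorem abs_score_le {δ : ℝ} (hδ : 0 ≤ δ) (hδ1 : δ ≤ 1 / 8) (v s : Fin d → Bool) (i : Fin d) :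
    |score δ v s i| ≤ 9 / 8 := by
  rw [score, abs_le]
  cases v i <;> cases s i <;> norm_num <;> constructor <;> linarith

/-- Only the `i`-th factor changes, and for a sign `z` one has `(1 + δ z)(z - δ) = (1 - δ²) z`. -/
theorem denseMass_sub_denseMass_flip {δ : ℝ} (hδ : 0 ≤ δ) (hδ1 : δ < 1) (v s : Fin d → Bool)
    (i : Fin d) :
    denseMass δ v s - denseMass δ (flip v i) s =
      2 * δ / (1 - δ ^ 2) * (denseMass δ v s * score δ v s i) := by
  have hne : 1 - δ ^ 2 ≠ 0 := by nlinarith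
  have h1 : ∏ j ∈ Finset.univ.erase i, (1 + δ * (sgn (flip v i j) * sgn (s j))) / 2 =
      ∏ j ∈ Finset.univ.erase i, (1 + δ * (sgn (v j) * sgn (s j))) / 2 :=
    Finset.prod_congr rfl fun j hj => by rw [flip_of_ne v (Finset.ne_of_mem_erase hj)]
  simp only [denseMass, score]
  rw [← Finset.mul_prod_erase _ _ (Finset.mem_univ i),
    ← Finset.mul_prod_erase _ (fun j => (1 + δ * (sgn (flip v i j) * sgn (s j))) / 2)
      (Finset.mem_univ i), h1, flip_same, sgn_not, neg_mul]
  have hz : (sgn (v i) * sgn (s i)) * (sgn (v i) * sgn (s i)) = 1 := by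
    rw [mul_mul_mul_comm, sgn_mul_self, sgn_mul_self, one_mul]
  generalize sgn (v i) * sgn (s i) = z at hz ⊢
  generalize ∏ j ∈ Finset.univ.erase i, (1 + δ * (sgn (v j) * sgn (s j))) / 2 = R
  rw [div_mul_eq_mul_div (2 * δ), eq_div_iff hne]
  linear_combination -(δ ^ 2 * R) * hz

/-- The scores are independent and centred with variance `1 - δ² ≤ 1`. As `9/16 * 9/8 ≤ 1`, the
inequality `exp x ≤ 1 + x + x²` applies to each factor, giving at most `1 + a i ^ 2 ≤ exp (a i ^
2)`. -/
theorem sum_denseMass_mul_exp_le {δ : ℝ} (hδ : 0 ≤ δ) (hδ1 : δ ≤ 1 / 8) (v : Fin d → Bool)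
    {a : Fin d → ℝ} (ha : ∀ i, |a i| ≤ 9 / 16) :
    ∑ s, denseMass δ v s * Real.exp (∑ i, a i * score δ v s i) ≤ Real.exp (∑ i, a i ^ 2) := by
  have hexp : ∀ x : ℝ, |x| ≤ 1 → Real.exp x ≤ 1 + x + x ^ 2 := fun x hx => by
    have := (abs_le.1 (Real.abs_exp_sub_one_sub_id_le hx)).2
    linarith
  simp only [Real.exp_sum]
  have h := sum_denseMass_mul_prod δ v fun i b => Real.exp (a i * (sgn (v i) * sgn b - δ))
  simp only [score, h]
  refine Finset.prod_le_prod (fun i _ => ?_) fun i _ => ?_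
  · have h1 : 0 ≤ (1 + δ * sgn (v i)) / 2 := by cases v i <;> simp <;> linarith
    have h2 : 0 ≤ (1 - δ * sgn (v i)) / 2 := by cases v i <;> simp <;> linarith
    positivity
  have hb : ∀ b, Real.exp (a i * (sgn (v i) * sgn b - δ)) ≤
      1 + a i * (sgn (v i) * sgn b - δ) + (a i * (sgn (v i) * sgn b - δ)) ^ 2 := fun b => by
    refine hexp _ ?_
    have h2 := abs_score_le hδ hδ1 v (fun _ => b) i
    rw [score] at h2
    rw [abs_mul]
    calc _ ≤ 9 / 16 * (9 / 8 : ℝ) := mul_le_mul (ha i) h2 (abs_nonneg _) (by norm_num)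
      _ ≤ 1 := by norm_num
  have ht := hb true
  have hf := hb false
  refine le_trans ?_ (Real.add_one_le_exp (a i ^ 2))
  simp only [sgn_true, sgn_false] at ht hf ⊢
  cases hv : v i
  all_goals
    simp only [hv, sgn_true, sgn_false] at ht hf ⊢
    refine (add_le_add (mul_le_mul_of_nonneg_left ht (by linarith))
      (mul_le_mul_of_nonneg_left hf (by linarith))).trans ?_
    nlinarith [mul_nonneg (sq_nonneg (a i)) (sq_nonneg δ)]

/-- A message of small probability carries little information: bound on the conditional means of the
scores in terms of the log-probability. -/
theorem sum_sq_sum_score_le {δ : ℝ} (hδ : 0 ≤ δ) (hδ1 : δ ≤ 1 / 8) (v : Fin d → Bool)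
    {w : (Fin d → Bool) → ℝ} (hw0 : ∀ s, 0 ≤ w s) (hw1 : ∀ s, w s ≤ 1)
    (hp : 0 < ∑ s, denseMass δ v s * w s) :
    ∑ i, (∑ s, denseMass δ v s * w s * score δ v s i) ^ 2 ≤
      4 * (∑ s, denseMass δ v s * w s) ^ 2 * -Real.log (∑ s, denseMass δ v s * w s) := by
  have hμ := denseMass_nonneg hδ (by linarith : δ ≤ 1) v
  set p := ∑ s, denseMass δ v s * w s with hpdef
  let m : Fin d → ℝ := fun i => (∑ s, denseMass δ v s * w s * score δ v s i) / p
  have hm : ∀ i, |m i| ≤ 9 / 8 := fun i => by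
    simp only [m]
    rw [abs_div, abs_of_pos hp, div_le_iff₀ hp, hpdef, Finset.mul_sum]
    refine (Finset.abs_sum_le_sum_abs _ _).trans (Finset.sum_le_sum fun s _ => ?_)
    rw [abs_mul, abs_of_nonneg (mul_nonneg (hμ s) (hw0 s)), mul_comm]
    exact mul_le_mul_of_nonneg_right (abs_score_le hδ hδ1 v s i) (mul_nonneg (hμ s) (hw0 s))
  let S := ∑ i, m i ^ 2
  -- Jensen for the law of the signs conditioned on the message, tilted by `m i / 2`. That law has
  -- density `w / p ≤ 1 / p`, so the unconditional exponential moment bounds it, and comparing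
  -- exponents gives `S / 2 ≤ S / 4 - log p`.
  have hjensen : Real.exp (S / 2) ≤
      ∑ s, (denseMass δ v s * w s / p) * Real.exp (∑ i, m i / 2 * score δ v s i) := by
    have h := convexOn_exp.map_sum_le (t := Finset.univ)
      (w := fun s => denseMass δ v s * w s / p) (p := fun s => ∑ i, m i / 2 * score δ v s i)
      (fun s _ => div_nonneg (mul_nonneg (hμ s) (hw0 s)) hp.le)
      (by rw [← Finset.sum_div, ← hpdef, div_self hp.ne']) (fun _ _ => Set.mem_univ _)
    simp only [smul_eq_mul] at h
    refine le_trans (le_of_eq (congrArg _ ?_)) h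
    simp only [Finset.mul_sum]
    rw [Finset.sum_comm]
    simp only [S]
    rw [Finset.sum_div]
    refine Finset.sum_congr rfl fun i _ => ?_
    have : ∑ s, denseMass δ v s * w s / p * (m i / 2 * score δ v s i) =
        m i / 2 * m i := by
      simp only [m]
      rw [Finset.sum_div, Finset.mul_sum]
      exact Finset.sum_congr rfl fun s _ => by ring
    rw [this]
    ring
  have hupper : ∑ s, (denseMass δ v s * w s / p) * Real.exp (∑ i, m i / 2 * score δ v s i) ≤
      Real.exp (S / 4) / p := by
    have h := sum_denseMass_mul_exp_le hδ hδ1 v (a := fun i => m i / 2) (fun i => by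
      rw [abs_div, abs_two]
      linarith [hm i])
    have e : ∑ i, (m i / 2) ^ 2 = S / 4 := by
      simp only [S]
      rw [Finset.sum_div]
      exact Finset.sum_congr rfl fun i _ => by ring
    rw [e] at h
    refine le_trans ?_ (div_le_div_of_nonneg_right h hp.le)
    rw [Finset.sum_div]
    refine Finset.sum_le_sum fun s _ => ?_
    rw [div_mul_eq_mul_div]
    refine div_le_div_of_nonneg_right (mul_le_mul_of_nonneg_right ?_ (Real.exp_pos _).le) hp.le
    exact mul_le_of_le_one_right (hμ s) (hw1 s)
  have hS : S ≤ 4 * -Real.log p := by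
    have h := hjensen.trans hupper
    have e : Real.exp (S / 4) / p = Real.exp (S / 4 - Real.log p) := by
      rw [Real.exp_sub, Real.exp_log hp]
    rw [e, Real.exp_le_exp] at h
    linarith
  have e : ∑ i, (∑ s, denseMass δ v s * w s * score δ v s i) ^ 2 = p ^ 2 * S := by
    simp only [S, m, Finset.mul_sum]
    refine Finset.sum_congr rfl fun i _ => ?_
    rw [div_pow, mul_div_cancel₀ _ (pow_ne_zero 2 hp.ne')]
  rw [e]
  nlinarith [mul_le_mul_of_nonneg_left hS (sq_nonneg p)]

/-- This is `log u ≤ u - 1` at `u = 1 / (p N)`. Summed over `N` messages the corrections `1 / N - p`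
cancel, so the entropy is at most `log N`. -/
theorem neg_mul_log_le {p N : ℝ} (hp : 0 < p) (hN : 0 < N) :
    p * -Real.log p ≤ p * Real.log N + (1 / N - p) := by
  have h := Real.log_le_sub_one_of_pos (by positivity : 0 < 1 / (p * N))
  rw [one_div, Real.log_inv, Real.log_mul hp.ne' hN.ne'] at h
  have h2 := mul_le_mul_of_nonneg_left h hp.le
  have e : p * ((p * N)⁻¹ - 1) = 1 / N - p := by field_simp
  rw [e] at h2
  linarith

variable {Y : Type} [Fintype Y]

theorem sum_sqHellinger_dense_le {r : ℕ} (hY : Fintype.card Y = 2 ^ r) {δ : ℝ} (hδ : 0 ≤ δ)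
    (hδ1 : δ ≤ 1 / 8) {w : (Fin d → Bool) → Y → ℝ} (hw0 : ∀ s y, 0 ≤ w s y)
    (hw1 : ∀ s, ∑ y, w s y = 1) (v : Fin d → Bool) :
    ∑ i, sqHellinger (fun y => ∑ s, denseMass δ v s * w s y)
        (fun y => ∑ s, denseMass δ (flip v i) s * w s y) ≤
      64 * δ ^ 2 * min (d : ℝ) r := by
  have hδ' : δ ≤ 1 := by linarith
  have hwle : ∀ s y, w s y ≤ 1 := fun s y => (hw1 s) ▸
    Finset.single_le_sum (f := w s) (fun y _ => hw0 s y) (Finset.mem_univ y)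
  let p : Y → ℝ := fun y => ∑ s, denseMass δ v s * w s y
  let e : Fin d → Y → ℝ := fun i y => ∑ s, denseMass δ v s * w s y * score δ v s i
  have hnn : ∀ u y, 0 ≤ ∑ s, denseMass δ u s * w s y := fun u y =>
    Finset.sum_nonneg fun s _ => mul_nonneg (denseMass_nonneg hδ hδ' u s) (hw0 s y)
  have hpsum : ∑ y, p y = 1 := by
    simp only [p]
    rw [Finset.sum_comm]
    simp [← Finset.mul_sum, hw1, sum_denseMass]
  have hdiff : ∀ i y, p y - ∑ s, denseMass δ (flip v i) s * w s y =
      2 * δ / (1 - δ ^ 2) * e i y := by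
    intro i y
    simp only [p, e]
    rw [← Finset.sum_sub_distrib, Finset.mul_sum]
    refine Finset.sum_congr rfl fun s _ => ?_
    rw [← sub_mul, denseMass_sub_denseMass_flip hδ (by linarith)]
    ring
  have hκ : (2 * δ / (1 - δ ^ 2)) ^ 2 ≤ 5 * δ ^ 2 := by
    rw [div_pow, div_le_iff₀ (by nlinarith)]
    have : (63 / 64 : ℝ) ≤ 1 - δ ^ 2 := by nlinarith
    nlinarith [mul_le_mul this this (by norm_num) (by linarith), sq_nonneg δ]
  have hsq : ∀ i y, (√(p y) - √(∑ s, denseMass δ (flip v i) s * w s y)) ^ 2 * p y ≤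
      5 * δ ^ 2 * e i y ^ 2 := by
    intro i y
    have h := sq_sqrt_sub_sqrt_mul_le (hnn v y) (hnn (flip v i) y)
      (le_add_of_nonneg_right (hnn (flip v i) y))
    refine h.trans ?_
    rw [hdiff i y, mul_pow]
    exact mul_le_mul_of_nonneg_right hκ (sq_nonneg _)
  -- All masses are positive because `δ < 1`, so a message of probability zero under `v` is never
  -- sent.
  have hzero : ∀ y, p y = 0 → ∀ u, ∑ s, denseMass δ u s * w s y = 0 := by
    intro y hy u
    have hz : ∀ s, w s y = 0 := fun s => by
      have h := (Finset.sum_eq_zero_iff_of_nonneg fun s _ =>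
        mul_nonneg (denseMass_nonneg hδ hδ' v s) (hw0 s y)).1 hy s (Finset.mem_univ s)
      refine (mul_eq_zero.1 h).resolve_left (ne_of_gt ?_)
      refine Finset.prod_pos fun i _ => ?_
      have := (abs_le.1 (abs_mul_sgn_mul_sgn hδ (v i) (s i)).le).1
      linarith
    simp [hz]
  -- The trivial bound, from `|score| ≤ 9/8` in each of the `d` coordinates.
  have hbd : ∀ y, ∑ i, (√(p y) - √(∑ s, denseMass δ (flip v i) s * w s y)) ^ 2 ≤
      64 * δ ^ 2 * (d * p y) := by
    intro y
    rcases (hnn v y).eq_or_lt with h | h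
    · simp [p, ← h, hzero y h.symm]
    · refine le_of_mul_le_mul_right ?_ h
      rw [Finset.sum_mul]
      refine (Finset.sum_le_sum fun i _ => hsq i y).trans ?_
      have hei : ∀ i, e i y ^ 2 ≤ 2 * p y ^ 2 := fun i => by
        have habs : |e i y| ≤ 9 / 8 * p y := by
          simp only [e, p]
          rw [Finset.mul_sum]
          refine (Finset.abs_sum_le_sum_abs _ _).trans (Finset.sum_le_sum fun s _ => ?_)
          have h3 := mul_nonneg (denseMass_nonneg hδ hδ' v s) (hw0 s y)
          rw [abs_mul, abs_of_nonneg h3, mul_comm]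
          exact mul_le_mul_of_nonneg_right (abs_score_le hδ hδ1 v s i) h3
        rw [← sq_abs]
        nlinarith [abs_nonneg (e i y), mul_self_le_mul_self (abs_nonneg (e i y)) habs]
      refine (Finset.sum_le_sum fun i _ =>
        mul_le_mul_of_nonneg_left (hei i) (by positivity)).trans ?_
      rw [Finset.sum_const, Finset.card_univ, Fintype.card_fin, nsmul_eq_mul]
      have : 0 ≤ (d : ℝ) * (δ ^ 2 * p y ^ 2) := by positivity
      have e3 : 64 * δ ^ 2 * (d * p y) * p y = 64 * ((d : ℝ) * (δ ^ 2 * p y ^ 2)) := by ring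
      change _ ≤ 64 * δ ^ 2 * (d * p y) * p y
      rw [e3]
      linarith
  -- The information bound: 5 from `hκ` times 4 from the score bound is 20, relaxed to the common
  -- constant 64.
  have hbr : ∀ y, ∑ i, (√(p y) - √(∑ s, denseMass δ (flip v i) s * w s y)) ^ 2 ≤
      64 * δ ^ 2 * (p y * Real.log (2 ^ r) + (1 / 2 ^ r - p y)) := by
    intro y
    rcases (hnn v y).eq_or_lt with h | h
    · have h0 : p y = 0 := h.symm
      simp only [hzero y h0, h0]
      simp
      positivity
    · have hent := neg_mul_log_le h (by positivity : (0 : ℝ) < 2 ^ r)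
      have hlog := sum_sq_sum_score_le hδ hδ1 v (fun s => hw0 s y) (fun s => hwle s y) h
      refine le_of_mul_le_mul_right ?_ h
      rw [Finset.sum_mul]
      refine (Finset.sum_le_sum fun i _ => hsq i y).trans ?_
      rw [← Finset.mul_sum]
      have hlog' : ∑ i, e i y ^ 2 ≤ 4 * p y ^ 2 * -Real.log (p y) := hlog
      have hlp : 0 ≤ -Real.log (p y) := by
        rw [neg_nonneg]
        refine Real.log_nonpos h.le ?_
        rw [← hpsum]
        exact Finset.single_le_sum (f := p) (fun y _ => hnn v y) (Finset.mem_univ y)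
      calc _ ≤ 5 * δ ^ 2 * (4 * p y ^ 2 * -Real.log (p y)) :=
            mul_le_mul_of_nonneg_left hlog' (by positivity)
        _ = 20 * (δ ^ 2 * p y * (p y * -Real.log (p y))) := by ring
        _ ≤ 64 * (δ ^ 2 * p y * (p y * -Real.log (p y))) := by
            have : 0 ≤ δ ^ 2 * p y * (p y * -Real.log (p y)) :=
              mul_nonneg (mul_nonneg (sq_nonneg _) h.le) (mul_nonneg h.le hlp)
            linarith
        _ ≤ 64 * (δ ^ 2 * p y * (p y * Real.log (2 ^ r) + (1 / 2 ^ r - p y))) := by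
            refine mul_le_mul_of_nonneg_left ?_ (by norm_num)
            exact mul_le_mul_of_nonneg_left hent (mul_nonneg (sq_nonneg _) h.le)
        _ = _ := by simp only [p]; ring
  simp only [sqHellinger]
  rw [Finset.sum_comm, mul_min_of_nonneg _ _ (by positivity)]
  refine le_min ?_ ?_
  · refine (Finset.sum_le_sum fun y _ => hbd y).trans (le_of_eq ?_)
    rw [← Finset.mul_sum, ← Finset.mul_sum, hpsum, mul_one]
  · refine (Finset.sum_le_sum fun y _ => hbr y).trans ?_
    rw [← Finset.mul_sum]
    refine mul_le_mul_of_nonneg_left ?_ (by positivity)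
    rw [Finset.sum_add_distrib, Finset.sum_sub_distrib, ← Finset.sum_mul, hpsum, Finset.sum_const,
      Finset.card_univ, hY, Real.log_pow]
    have hl : Real.log 2 ≤ 1 := by linarith [Real.log_two_lt_d9]
    have hr : (r : ℝ) * Real.log 2 ≤ r := mul_le_of_le_one_right (Nat.cast_nonneg r) hl
    have : (2 ^ r : ℕ) • (1 / 2 ^ r : ℝ) = 1 := by
      rw [nsmul_eq_mul]
      push_cast
      field_simp
    rw [this]
    linarith

end Dense

/-! ### Norms, choice of the bias and the final bounds -/

variable {d : ℕ}

theorem pNorm_le {p : ℝ≥0∞} (hp : 1 ≤ p) {x : Pt d} {b : ℝ} (hb : 0 ≤ b) (hx : ∀ i, |x i| ≤ b) :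
    pNorm p x ≤ (d : ℝ) ^ (p⁻¹).toReal * b := by
  have : Fact (1 ≤ p) := ⟨hp⟩
  have h := (PiLp.lipschitzWith_toLp p fun _ : Fin d => ℝ).dist_le_mul x 0
  rw [dist_zero_right, WithLp.toLp_zero, dist_zero_right, one_div, Fintype.card_fin] at h
  refine h.trans ?_
  push_cast
  refine mul_le_mul_of_nonneg_left ?_ (by positivity)
  exact (pi_norm_le_iff_of_nonneg hb).2 hx

theorem cube_mem_domains {p : ℝ≥0∞} (hp : 1 ≤ p) {b D : ℝ} (hb : 0 ≤ b)
    (hD : (d : ℝ) ^ (p⁻¹).toReal * (2 * b) ≤ D) : cube d b ∈ domains d p D := by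
  refine ⟨⟨0, fun i => by simpa using hb⟩, fun x hx y hy => ?_⟩
  refine (pNorm_le hp (by linarith) fun i => ?_).trans hD
  calc |x i - y i| ≤ |x i| + |y i| := abs_sub _ _
    _ ≤ 2 * b := by linarith [hx i, hy i]

theorem pNorm_sparseVector {q : ℝ≥0∞} (hq : 1 ≤ q) (B : ℝ) (ω : Fin d × Bool) :
    pNorm q (sparseVector B ω) = |B| := by
  have : Fact (1 ≤ q) := ⟨hq⟩
  have h := PiLp.norm_single q (fun _ : Fin d => ℝ) ω.1 (B * sgn ω.2)
  rw [Real.norm_eq_abs, abs_mul, abs_sgn, mul_one] at h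
  exact h

theorem sq_pNorm_denseVector_le {q : ℝ≥0∞} (hq : 1 ≤ q) (a : ℝ) (s : Fin d → Bool) :
    pNorm q (denseVector a s) ^ 2 ≤ ((d : ℝ) ^ (q⁻¹).toReal * |a|) ^ 2 := by
  have : Fact (1 ≤ q) := ⟨hq⟩
  refine pow_le_pow_left₀ ?_ (pNorm_le hq (abs_nonneg a) fun i => le_of_eq ?_) 2
  · exact norm_nonneg (WithLp.toLp q (denseVector a s) : PiLp q fun _ : Fin d => ℝ)
  · rw [denseVector, abs_mul, abs_sgn, mul_one]

theorem le_iSup_minmaxError {p : ℝ≥0∞} {b B D L : ℝ} {T : ℕ} {Y : Type} [MeasurableSpace Y]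
    [Countable Y] [MeasurableSingletonClass Y] {𝒲 : Set (Channel d Y)} (hp : 1 ≤ p) (hb : 0 ≤ b)
    (hD : (d : ℝ) ^ (p⁻¹).toReal * (2 * b) ≤ D)
    (h : ((L : ℝ) : EReal) ≤ minmaxError (cube d b) (convexClass p B (cube d b)) T 𝒲) :
    (L : EReal) ≤ ⨆ X ∈ domains d p D, minmaxError X (convexClass p B X) T 𝒲 :=
  h.trans (le_iSup₂_of_le (f := fun X (_ : X ∈ domains d p D) =>
    minmaxError X (convexClass p B X) T 𝒲) _ (cube_mem_domains hp hb hD) le_rfl)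

theorem one_le_conjExponent (p : ℝ≥0∞) : 1 ≤ p.conjExponent := le_self_add

theorem toReal_inv_add_toReal_inv_conjExponent {p : ℝ≥0∞} (hp : 1 ≤ p) :
    (p⁻¹).toReal + (p.conjExponent⁻¹).toReal = 1 := by
  have : p.HolderConjugate p.conjExponent := .conjExponent hp
  have hq := one_le_conjExponent p
  rw [← ENNReal.toReal_add, ENNReal.HolderConjugate.inv_add_inv_eq_one, ENNReal.toReal_one]
  · exact ENNReal.inv_ne_top.2 (zero_lt_one.trans_le hp).ne'
  · exact ENNReal.inv_ne_top.2 (zero_lt_one.trans_le hq).ne'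

/-- The lower bound by sparse gradients. -/
theorem sparse_lower_bound {r T : ℕ} {p : ℝ≥0∞} {D B : ℝ} (hd : 1 ≤ d) (hT0 : 0 < T) (hp : 1 ≤ p)
    (hD : 0 < D) (hB : 0 < B) (hT : (1 / 4 : ℝ) * ((d : ℝ) ^ 2 / min ((2 : ℝ) ^ r) d) ≤ T) :
    ((1 / 16 * (D * B * d / ((d : ℝ) ^ (p⁻¹).toReal * √(T * min ((2 : ℝ) ^ r) d))) : ℝ) : EReal) ≤
      ⨆ X ∈ domains d p D, minmaxError X (convexClass p B X) T (comChannels d r) := by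
  have hd0 : (0 : ℝ) < d := by positivity
  have hT0' : (0 : ℝ) < T := by positivity
  set m := min ((2 : ℝ) ^ r) d with hm
  have hm0 : 0 < m := lt_min (by positivity) hd0
  set dp := (d : ℝ) ^ (p⁻¹).toReal
  have hdp : 0 < dp := by positivity
  set R := √(T * m)
  have hR : 0 < R := by positivity
  have hR2 : R ^ 2 = T * m := Real.sq_sqrt (by positivity)
  -- This makes `T * (4 δ² m / d)` equal to `d / 4`; the condition `δ ≤ 1/2` is then exactly the
  -- hypothesis on `T`.
  set δ := (d : ℝ) / (4 * R) with hδdef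
  have hδ : 0 ≤ δ := by positivity
  have hδ1 : δ ≤ 1 / 2 := by
    rw [hδdef, div_le_iff₀ (by positivity)]
    have h : (d : ℝ) ^ 2 ≤ (2 * R) ^ 2 := by
      rw [mul_pow, hR2]
      rw [← mul_div_assoc, div_le_iff₀ hm0] at hT
      linarith
    have := (sq_le_sq₀ hd0.le (by positivity)).1 h
    linarith
  have hb : 0 ≤ D / (2 * dp) := by positivity
  refine le_iSup_minmaxError hp hb (le_of_eq (by change dp * _ = D; field_simp)) ?_
  have key := le_minmaxError (Y := Fin r → Bool) (T := T) (𝒲 := comChannels d r) (p := p) (B := B)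
    (b := D / (2 * dp)) (c := B * δ / d) (β := 4 * δ ^ 2 * m / d) (μ := sparseMass δ)
    (G := sparseVector B) (fun v => sparseMass_nonneg hδ (by linarith) v)
    (fun v => sum_sparseMass hd δ v) hb (by positivity)
    (fun v i => sum_sparseMass_mul_sparseVector δ B v i)
    (fun ω => by rw [pNorm_sparseVector (one_le_conjExponent p), sq_abs])
    (fun w hw0 hw1 v => by
      have h := sum_sqHellinger_sparse_le hd hδ hδ1 hw0 hw1 v
      simpa [hm] using h)
    (by
      refine le_of_eq ?_
      rw [hδdef, div_pow, mul_pow, hR2]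
      field_simp)
  refine le_trans (le_of_eq ?_) key
  rw [hδdef]
  congr 1
  field_simp
  norm_num

/-- The lower bound by dense gradients. -/
theorem dense_lower_bound {r T : ℕ} {p : ℝ≥0∞} {D B : ℝ} (hd : 1 ≤ d) (hr : 1 ≤ r) (hp : 1 ≤ p)
    (hD : 0 < D) (hB : 0 < B) (hT : (d : ℝ) ≤ 4 * T) :
    ((1 / 64 * (D * B * √(d / (T * min (d : ℝ) r))) : ℝ) : EReal) ≤
      ⨆ X ∈ domains d p D, minmaxError X (convexClass p B X) T (comChannels d r) := by
  have hd1 : (1 : ℝ) ≤ d := by exact_mod_cast hd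
  have hr1 : (1 : ℝ) ≤ r := by exact_mod_cast hr
  have hd0 : (0 : ℝ) < d := by positivity
  have hT0 : (0 : ℝ) < T := by linarith
  set m := min (d : ℝ) r with hm
  have hm1 : 1 ≤ m := le_min hd1 hr1
  have hm0 : 0 < m := by linarith
  set dp := (d : ℝ) ^ (p⁻¹).toReal with hdpdef
  set dq := (d : ℝ) ^ (p.conjExponent⁻¹).toReal with hdqdef
  have hdp : 0 < dp := by positivity
  have hdq : 0 < dq := by positivity
  have hpq : dp * dq = d := by
    rw [hdpdef, hdqdef, ← Real.rpow_add hd0, toReal_inv_add_toReal_inv_conjExponent hp,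
      Real.rpow_one]
  set R := √(d / (T * m))
  have hR2 : R ^ 2 = d / (T * m) := Real.sq_sqrt (by positivity)
  have hR : 0 ≤ R := Real.sqrt_nonneg _
  -- This makes `T * (64 δ² m)` equal to `d / 4`; `δ ≤ 1/8` means `R ≤ 2`, which follows from `d ≤ 4
  -- T` and `m ≥ 1`.
  set δ := R / 16 with hδdef
  have hδ : 0 ≤ δ := by positivity
  have hδ1 : δ ≤ 1 / 8 := by
    have h : R ^ 2 ≤ 2 ^ 2 := by
      rw [hR2, div_le_iff₀ (by positivity)]
      nlinarith
    have := (sq_le_sq₀ hR zero_le_two).1 h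
    linarith
  have hb : 0 ≤ D / (2 * dp) := by positivity
  refine le_iSup_minmaxError hp hb (le_of_eq (by change dp * _ = D; field_simp)) ?_
  have key := le_minmaxError (Y := Fin r → Bool) (T := T) (𝒲 := comChannels d r) (p := p) (B := B)
    (b := D / (2 * dp)) (c := B / dq * δ) (β := 64 * δ ^ 2 * m) (μ := denseMass δ)
    (G := denseVector (B / dq)) (fun v => denseMass_nonneg hδ (by linarith) v)
    (fun v => sum_denseMass δ v) hb (by positivity)
    (fun v i => sum_denseMass_mul_denseVector δ (B / dq) v i)
    (fun s => by
      refine (sq_pNorm_denseVector_le (one_le_conjExponent p) _ s).trans (le_of_eq ?_)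
      rw [← hdqdef, abs_of_nonneg (by positivity), mul_div_cancel₀ _ hdq.ne'])
    (fun w hw0 hw1 v => sum_sqHellinger_dense_le (by simp) hδ hδ1 hw0 hw1 v)
    (by
      refine le_of_eq ?_
      rw [hδdef, div_pow, hR2]
      field_simp
      norm_num)
  refine le_trans (le_of_eq ?_) key
  rw [hδdef]
  congr 1
  rw [← hpq]
  field_simp
  ring

theorem one_div_twelve_mul_sqrt_le : 1 / (12 * √58) ≤ (1 / 64 : ℝ) := by
  have h : (6 : ℝ) ≤ √58 := Real.le_sqrt_of_sq_le (by norm_num)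
  exact one_div_le_one_div_of_le (by norm_num) (by linarith)

end InfoOpt

end

theorem theoremt (d r T : ℕ) (p : ℝ≥0∞) (D B : ℝ)
    (hd : 1 ≤ d) (hr : 1 ≤ r) (hp : 2 ≤ p) (hD : 0 < D) (hB : 0 < B)
    (hT : (1 / 4 : ℝ) * ((d : ℝ) ^ 2 / min ((2 : ℝ) ^ r) (d : ℝ)) ≤ (T : ℝ)) :
    ((max
        (1 / (12 * √58) * D * B * (d : ℝ) ^ ((1 / 2 : ℝ) - (p⁻¹).toReal) / √(T : ℝ) *
          √((d : ℝ) / min (d : ℝ) ((2 : ℝ) ^ r)))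
        (1 / (12 * √58) * D * B / √(T : ℝ) *
          √((d : ℝ) / min (d : ℝ) (r : ℝ))) : ℝ) : EReal) ≤
      ⨆ X ∈ InfoOpt.domains d p D,
        InfoOpt.minmaxError X (InfoOpt.convexClass p B X) T (InfoOpt.comChannels d r) := by
  have hd0 : (0 : ℝ) < d := by positivity
  have hp1 : 1 ≤ p := one_le_two.trans hp
  have hm0 : 0 < min ((2 : ℝ) ^ r) (d : ℝ) := lt_min (by positivity) hd0
  -- The dense bound needs only this consequence of the hypothesis, obtained from `min (2^r) d ≤ d`.
  have hdT : (d : ℝ) ≤ 4 * T := by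
    have h : (d : ℝ) ≤ (d : ℝ) ^ 2 / min ((2 : ℝ) ^ r) (d : ℝ) := by
      rw [le_div_iff₀ hm0, sq]
      exact mul_le_mul_of_nonneg_left (min_le_right _ _) hd0.le
    linarith
  have hT0 : (0 : ℝ) < T := by linarith
  -- The two bounds hold with the constants 1/16 and 1/64, both at least `1 / (12 √58)`.
  have hc := InfoOpt.one_div_twelve_mul_sqrt_le
  rcases max_choice
      (1 / (12 * √58) * D * B * (d : ℝ) ^ ((1 / 2 : ℝ) - (p⁻¹).toReal) / √(T : ℝ) *
        √((d : ℝ) / min (d : ℝ) ((2 : ℝ) ^ r)))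
      (1 / (12 * √58) * D * B / √(T : ℝ) * √((d : ℝ) / min (d : ℝ) (r : ℝ))) with h | h
  · rw [h]
    refine le_trans (EReal.coe_le_coe_iff.2 ?_)
      (InfoOpt.sparse_lower_bound hd (by exact_mod_cast hT0) hp1 hD hB hT)
    rw [min_comm, Real.rpow_sub hd0, ← Real.sqrt_eq_rpow, Real.sqrt_div hd0.le,
      Real.sqrt_mul hT0.le]
    have hs : √(d : ℝ) * √(d : ℝ) = d := Real.mul_self_sqrt hd0.le
    have hsm : 0 < √(min ((2 : ℝ) ^ r) (d : ℝ)) := Real.sqrt_pos.2 hm0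
    calc _ = 1 / (12 * √58) * (D * B * (√(d : ℝ) * √(d : ℝ)) /
          ((d : ℝ) ^ (p⁻¹).toReal * (√(T : ℝ) * √(min ((2 : ℝ) ^ r) (d : ℝ))))) := by field_simp
      _ ≤ _ := by
        rw [hs]
        exact mul_le_mul_of_nonneg_right (hc.trans (by norm_num)) (by positivity)
  · rw [h]
    refine le_trans (EReal.coe_le_coe_iff.2 ?_) (InfoOpt.dense_lower_bound hd hr hp1 hD hB hdT)
    rw [mul_comm (T : ℝ), ← div_div (d : ℝ), Real.sqrt_div' _ hT0.le]
    calc _ = 1 / (12 * √58) * (D * B * (√((d : ℝ) / min (d : ℝ) r) / √(T : ℝ))) := by ring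
      _ ≤ _ := mul_le_mul_of_nonneg_right hc (by positivity)
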